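/- Let $N\in\mathbb N$, let $h\in\mathbb R$, $t\ge 0$, and let $(g_{ij})_{1\le i<j\le N}$ be i.i.d. centered Gaussian random variables of variance $t/N$; set $g_{ji}=g_{ij}$ and $g_{ii}=0$. For $A\subset\{1,\dots,N\}$ and a boundary condition $\tau\in\{-1,1\}^{A}$, let $$H_N^{[A]}(\sigma)=\sum_{\substack{1\le i<j\le N\\ i,j\notin A}} g_{ij}\sigma_i\sigma_j+\sum_{i\notin A}\Big(h+\sum_{j\in A}g_{ij}\tau_j\Big)\sigma_i,\qquad \sigma\in\{-1,1\}^{\{1,\dots,N\}\setminus A},$$ be the Hamiltonian of the Sherrington--Kirkpatrick model conditioned on the spins in $A$ being equal to $\tau$, let $\langle f\rangle^{[A]}=\sum_\sigma f(\sigma)e^{H_N^{[A]}(\sigma)}\big/\sum_\sigma e^{H_N^{[A]}(\sigma)}$ be the corresponding Gibbs expectation, and for $i,j\notin A$ let $$m_{ij}^{[A]}=\langle\sigma_i\sigma_j\rangle^{[A]}-\langle\sigma_i\rangle^{[A]}\langle\sigma_j\rangle^{[A]}.$$ **Lemma.** Let $0\le t<\log 2$. Then there is $\epsilon_0=\epsilon_0(t)>0$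 such that for every $0<\epsilon\le\epsilon_0$ there is a constant $C_{t,\epsilon}>0$, depending only on $t$ and $\epsilon$ (in particular independent of $N$, $h$ and $A$), such that for all $N\in\mathbb N$, $h\in\mathbb R$, $A\subset\{1,\dots,N\}$ and all $i\ne j$ with $i,j\notin A$, the random variables $\big|m_{ij}^{[A]}\big|^{2+\epsilon}$ are integrable and $$\sup_{\tau\in\{-1,1\}^{A}}\mathbb E\,\big|m_{ij}^{[A]}\big|^{2+\epsilon}\le\frac{C_{t,\epsilon}}{N^{1+\epsilon/2}}.$$ -/

import Mathlib

open MeasureTheory ProbabilityTheory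

namespace SK

/-- The index set of the couplings: pairs `(i, j)` of sites with `i < j`. -/
abbrev Pair (N : ℕ) : Type := {p : Fin N × Fin N // p.1 < p.2}

/-- The symmetric coupling matrix with zero diagonal whose entries above the diagonal are the
given numbers `x`. -/
def coupling {N : ℕ} (x : Pair N → ℝ) (i j : Fin N) : ℝ :=
  if hij : i < j then x ⟨(i, j), hij⟩ else if hji : j < i then x ⟨(j, i), hji⟩ else 0

/-- The value in `ℝ` of a spin; the type `ℤˣ` has exactly the two elements `1` and `-1`. -/
def spin (s : ℤˣ) : ℝ := ((s : ℤ) : ℝ)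

variable {N : ℕ}

/-- The sites whose spins are not conditioned on. -/
abbrev Free (A : Finset (Fin N)) : Type := {i : Fin N // i ∉ A}

/-- The reduced Hamiltonian of the system, given that the spins on `A` are equal to `τ`. -/
def hamiltonian (g : Fin N → Fin N → ℝ) (h : ℝ) (A : Finset (Fin N)) (τ : A → ℤˣ)
    (σ : Free A → ℤˣ) : ℝ :=
  (∑ i : Free A, ∑ j : Free A,
      if i.1 < j.1 then g i.1 j.1 * spin (σ i) * spin (σ j) else 0) +
    ∑ i : Free A, (h + ∑ j : A, g i.1 j.1 * spin (τ j)) * spin (σ i)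

/-- The partition function of the reduced Hamiltonian. -/
noncomputable def partitionFunction (g : Fin N → Fin N → ℝ) (h : ℝ) (A : Finset (Fin N))
    (τ : A → ℤˣ) : ℝ :=
  ∑ σ : Free A → ℤˣ, Real.exp (hamiltonian g h A τ σ)

/-- The Gibbs expectation of the observable `f` under the reduced Hamiltonian. -/
noncomputable def gibbs (g : Fin N → Fin N → ℝ) (h : ℝ) (A : Finset (Fin N)) (τ : A → ℤˣ)
    (f : (Free A → ℤˣ) → ℝ) : ℝ :=
  (∑ σ : Free A → ℤˣ, f σ * Real.exp (hamiltonian g h A τ σ)) / partitionFunction g h A τ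

/-- The magnetization at the site `i`, conditionally on the spins on `A`. -/
noncomputable def magnetization (g : Fin N → Fin N → ℝ) (h : ℝ) (A : Finset (Fin N))
    (τ : A → ℤˣ) (i : Free A) : ℝ :=
  gibbs g h A τ fun σ => spin (σ i)

/-- The two-point function of the sites `i` and `j`, conditionally on the spins on `A`. -/
noncomputable def twoPoint (g : Fin N → Fin N → ℝ) (h : ℝ) (A : Finset (Fin N))
    (τ : A → ℤˣ) (i j : Free A) : ℝ :=
  gibbs g h A τ (fun σ => spin (σ i) * spin (σ j)) -
    magnetization g h A τ i * magnetization g h A τ j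

end SK

/-! The moments are bounded by a recursion that removes one site at a time. Conditioning on the spin
at `i` gives `m_ij = (1 - m_i²) u`, where `u` is half the change of the magnetization at `j`, in the
system without `i`, when the field `(g_ik)_k` exerted by `i` is reversed (`corr_eq`). So `|m_ij| ≤
|u|`. Given the other couplings, `u` is an odd function of the Gaussians `g_ik`, and its derivative
in `g_ik` is a truncated two-point function of `j` and `k` in the smaller system, averaged over the
two signs of the field.

An odd function has mean zero, so the Poincaré inequality applied to `u|u|^(q-1)`, followed by
Young's inequality, gives `E|u|^(2q) ≤ (q² t/N)^q E(∑_k (∂_k u)²)^q`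
(`integral_abs_rpow_le_of_odd`). The term `k = j` is merely bounded; the others are handled by
convexity. If `M` bounds the moments of order `2q` of the smaller system uniformly in the
deterministic external field, those of the larger system are at most `(q² t/N)^q 2^(q-1) (4^q + N^q
M)`. Uniformity in the field lets the field of `i` be frozen, since it is independent of the
remaining interactions. The factor of `M` is `(q² t)^q 2^(q-1)`, which tends to `t` as `q → 1`; for
`t < log 2` and `q ≤ 11/10` it is below one, and the recursion closes with `M` of order `N^(-q)`.

The boundary condition changes only the external field, through couplings independent of those
between free sites, so it is covered by the same uniformity. Finally `2 + ε = 2q`. -/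

namespace SK

open scoped NNReal

/-! ### The Gaussian Poincaré inequality -/

/-- **Stein's identity** for a centred Gaussian variable and a function of linear growth with
bounded derivative. -/
theorem integral_mul_self_gaussianReal (v : ℝ≥0) {F F' : ℝ → ℝ} {C : ℝ}
    (hF : ∀ x, HasDerivAt F (F' x) x) (hF'c : Continuous F') (hF'b : ∀ x, |F' x| ≤ C)
    (hFb : ∀ x, |F x| ≤ C * |x|) :
    ∫ x, x * F x ∂(gaussianReal 0 v) = v * ∫ x, F' x ∂(gaussianReal 0 v) := by
  rcases eq_or_ne v 0 with rfl | hv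
  · simp
  have hFc : Continuous F := continuous_iff_continuousAt.2 fun x => (hF x).continuousAt
  have hsq : Integrable (fun x : ℝ => x ^ 2) (gaussianReal 0 v) :=
    (memLp_id_gaussianReal 2).integrable_sq
  have habs : Integrable (fun x : ℝ => x) (gaussianReal 0 v) :=
    (memLp_id_gaussianReal 1).integrable (by simp)
  have hC : 0 ≤ C := (abs_nonneg _).trans (hF'b 0)
  have i1 : Integrable (fun x => x * F x) (gaussianReal 0 v) := by
    refine (hsq.const_mul C).mono' (by fun_prop) (ae_of_all _ fun x => ?_)
    rw [norm_mul, Real.norm_eq_abs, Real.norm_eq_abs]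
    calc |x| * |F x| ≤ |x| * (C * |x|) := by gcongr; exact hFb x
      _ = C * x ^ 2 := by rw [← sq_abs x]; ring
  have i2 : Integrable F' (gaussianReal 0 v) :=
    Integrable.of_bound hF'c.aestronglyMeasurable C (ae_of_all _ hF'b)
  have i3 : Integrable F (gaussianReal 0 v) := by
    refine (habs.abs.const_mul C).mono' (by fun_prop) (ae_of_all _ fun x => ?_)
    simpa using hFb x
  have key : ∀ {G : ℝ → ℝ}, Continuous G → Integrable G (gaussianReal 0 v) →
      Integrable (fun x => gaussianPDFReal 0 v x * G x) volume := by
    intro G _ h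
    rw [gaussianReal_of_var_ne_zero _ hv] at h
    have := (integrable_withDensity_iff_integrable_smul₀' (measurable_gaussianPDF 0 v).aemeasurable
      (ae_of_all _ fun x => gaussianPDF_lt_top)).1 h
    simpa [toReal_gaussianPDF] using this
  have hpdf : ∀ x, HasDerivAt (gaussianPDFReal 0 v) (-(x / v) * gaussianPDFReal 0 v x) x := by
    intro x
    have hv' : (v : ℝ) ≠ 0 := by exact_mod_cast hv
    unfold gaussianPDFReal
    have h1 : HasDerivAt (fun x : ℝ => -(x - 0) ^ 2 / (2 * (v : ℝ))) (-(x / v)) x := by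
      have := (((hasDerivAt_id x).sub_const 0).pow 2).neg.div_const (2 * (v : ℝ))
      refine this.congr_deriv ?_
      simp; field_simp
    have := (h1.exp).const_mul ((√(2 * Real.pi * v))⁻¹)
    refine this.congr_deriv ?_
    ring
  -- Since the density `φ` satisfies `v φ' = -x φ`, the difference of the two sides is the integral
  -- of `(v φ F)'`, which vanishes.
  have hder : ∀ x, HasDerivAt (fun x => v * (gaussianPDFReal 0 v x * F x))
      (v * (gaussianPDFReal 0 v x * F' x) - gaussianPDFReal 0 v x * (x * F x)) x := by
    intro x
    have hv' : (v : ℝ) ≠ 0 := by exact_mod_cast hv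
    refine (((hpdf x).mul (hF x)).const_mul (v : ℝ)).congr_deriv ?_
    field_simp
    ring
  have h0 := integral_eq_zero_of_hasDerivAt_of_integrable hder
    (((key hF'c i2).const_mul _).sub (key (by fun_prop) i1)) ((key hFc i3).const_mul _)
  rw [integral_sub ((key hF'c i2).const_mul _) (key (by fun_prop) i1), integral_const_mul] at h0
  rw [integral_gaussianReal_eq_integral_smul hv, integral_gaussianReal_eq_integral_smul hv]
  simp only [smul_eq_mul]
  linarith

/-- The square of an increment of `f` is at most the increment of the identity times the increment
of a primitive of the square of the derivative of `f`. -/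
theorem sq_sub_le_mul_sub {f f' Φ : ℝ → ℝ} (hf : ∀ x, HasDerivAt f (f' x) x)
    (hΦ : ∀ x, HasDerivAt Φ (f' x ^ 2) x) (x y : ℝ) :
    (f x - f y) ^ 2 ≤ (x - y) * (Φ x - Φ y) := by
  wlog hxy : y < x generalizing x y
  · rcases (not_lt.1 hxy).lt_or_eq with h | rfl
    · have := this y x h
      linarith
    · simp
  set c := (f x - f y) / (x - y)
  have hpos : 0 < x - y := sub_pos.2 hxy
  have hc : c * (x - y) = f x - f y := by simp only [c]; field_simp
  -- With `c` the mean slope of `f`, this function has derivative `(f' - c)² ≥ 0`. Its monotonicity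
  -- is the Cauchy–Schwarz inequality on `[y, x]`.
  have hd : ∀ z, HasDerivAt (fun z => Φ z - 2 * c * f z + c ^ 2 * z) ((f' z - c) ^ 2) z := by
    intro z
    refine (((hΦ z).sub ((hf z).const_mul (2 * c))).add
      ((hasDerivAt_id z).const_mul (c ^ 2))).congr_deriv ?_
    ring
  have hmono : Monotone (fun z => Φ z - 2 * c * f z + c ^ 2 * z) :=
    monotone_of_deriv_nonneg (fun z => (hd z).differentiableAt) fun z => by
      rw [(hd z).deriv]; positivity
  have h := hmono hxy.le
  simp only at h
  have hc2 : c ^ 2 * (x - y) = c * (f x - f y) := by rw [← hc]; ring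
  have h2 : 0 ≤ Φ x - Φ y - c * (f x - f y) := by linarith
  calc (f x - f y) ^ 2 = (x - y) * (c * (f x - f y)) := by rw [← hc]; ring
    _ ≤ (x - y) * (Φ x - Φ y) := by gcongr; linarith

/-- Expanding over two independent copies gives twice the covariance, so pointwise bounds on
products of increments become covariance bounds. -/
theorem integral_prod_sub_mul_sub {α : Type*} [MeasurableSpace α] (μ : Measure α)
    [IsProbabilityMeasure μ] {f g : α → ℝ} (hf : Integrable f μ) (hg : Integrable g μ)
    (hfg : Integrable (fun x => f x * g x) μ) :
    Integrable (fun z : α × α => (f z.1 - f z.2) * (g z.1 - g z.2)) (μ.prod μ) ∧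
    ∫ z : α × α, (f z.1 - f z.2) * (g z.1 - g z.2) ∂(μ.prod μ) =
      2 * (∫ x, f x * g x ∂μ - (∫ x, f x ∂μ) * ∫ x, g x ∂μ) := by
  have i1 : Integrable (fun z : α × α => f z.1 * g z.1) (μ.prod μ) := hfg.comp_fst μ
  have i2 : Integrable (fun z : α × α => f z.2 * g z.2) (μ.prod μ) := hfg.comp_snd μ
  have i3 : Integrable (fun z : α × α => f z.1 * g z.2) (μ.prod μ) := hf.mul_prod hg
  have i4 : Integrable (fun z : α × α => g z.1 * f z.2) (μ.prod μ) := hg.mul_prod hf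
  have e : (fun z : α × α => (f z.1 - f z.2) * (g z.1 - g z.2)) = fun z =>
      (f z.1 * g z.1 + f z.2 * g z.2) - (f z.1 * g z.2 + g z.1 * f z.2) := by
    ext z; ring
  have i5 : Integrable (fun z : α × α => f z.1 * g z.1 + f z.2 * g z.2) (μ.prod μ) := i1.add i2
  have i6 : Integrable (fun z : α × α => f z.1 * g z.2 + g z.1 * f z.2) (μ.prod μ) := i3.add i4
  refine ⟨e ▸ i5.sub i6, ?_⟩
  rw [e, integral_sub i5 i6, integral_add i1 i2, integral_add i3 i4,
    integral_fun_fst (fun x => f x * g x), integral_fun_snd (fun x => f x * g x),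
    integral_prod_mul, integral_prod_mul]
  simp
  ring

/-- **Gaussian Poincaré inequality** on the line. -/
theorem gaussian_poincare_real (v : ℝ≥0) {f f' : ℝ → ℝ} {C D : ℝ}
    (hf : ∀ x, HasDerivAt f (f' x) x) (hfb : ∀ x, |f x| ≤ D) (hf'c : Continuous f')
    (hf'b : ∀ x, |f' x| ≤ C) :
    ∫ x, f x ^ 2 ∂(gaussianReal 0 v) - (∫ x, f x ∂(gaussianReal 0 v)) ^ 2 ≤
      v * ∫ x, f' x ^ 2 ∂(gaussianReal 0 v) := by
  have hfc : Continuous f := continuous_iff_continuousAt.2 fun x => (hf x).continuousAt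
  have hD : 0 ≤ D := (abs_nonneg _).trans (hfb 0)
  set Φ : ℝ → ℝ := fun x => ∫ s in (0 : ℝ)..x, f' s ^ 2
  have hΦ : ∀ x, HasDerivAt Φ (f' x ^ 2) x := fun x =>
    intervalIntegral.integral_hasDerivAt_right ((hf'c.pow 2).intervalIntegrable _ _)
      ((hf'c.pow 2).stronglyMeasurableAtFilter _ _) (hf'c.pow 2).continuousAt
  have hf'2 : ∀ x, |f' x ^ 2| ≤ C ^ 2 := fun x => by
    rw [abs_pow]; gcongr; exact hf'b x
  have hΦb : ∀ x, |Φ x| ≤ C ^ 2 * |x| := fun x => by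
    have := intervalIntegral.norm_integral_le_of_norm_le_const (a := 0) (b := x)
      (f := fun s => f' s ^ 2) (C := C ^ 2) fun s _ => hf'2 s
    simpa using this
  have hΦc : Continuous Φ := continuous_iff_continuousAt.2 fun x => (hΦ x).continuousAt
  set γ := gaussianReal 0 v
  have hid : Integrable (fun x : ℝ => x) γ := (memLp_id_gaussianReal 1).integrable (by simp)
  have hsq : Integrable (fun x : ℝ => x ^ 2) γ := (memLp_id_gaussianReal 2).integrable_sq
  have i1 : Integrable (fun x => x * Φ x) γ := by
    refine (hsq.const_mul (C ^ 2)).mono' (by fun_prop) (ae_of_all _ fun x => ?_)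
    rw [norm_mul, Real.norm_eq_abs, Real.norm_eq_abs]
    calc |x| * |Φ x| ≤ |x| * (C ^ 2 * |x|) := by gcongr; exact hΦb x
      _ = C ^ 2 * x ^ 2 := by rw [← sq_abs x]; ring
  have i3 : Integrable Φ γ := by
    refine (hid.abs.const_mul (C ^ 2)).mono' (by fun_prop) (ae_of_all _ fun x => ?_)
    simpa using hΦb x
  have j1 : Integrable f γ :=
    Integrable.of_bound hfc.aestronglyMeasurable D (ae_of_all _ hfb)
  have j2 : Integrable (fun x => f x * f x) γ := by
    refine Integrable.of_bound (by fun_prop) (D * D) (ae_of_all _ fun x => ?_)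
    rw [norm_mul]
    exact mul_le_mul (hfb x) (hfb x) (norm_nonneg _) hD
  obtain ⟨a1, a2⟩ := integral_prod_sub_mul_sub γ j1 j1 j2
  obtain ⟨b1, b2⟩ := integral_prod_sub_mul_sub γ hid i3 i1
  -- Over two independent copies the left side becomes `2 Var f` and the right side `2 Cov(x, Φ)`,
  -- which Stein's identity turns into `2 v E f'²`.
  have hle := integral_mono a1 b1 fun z => by
    have := sq_sub_le_mul_sub hf hΦ z.1 z.2
    simpa [sq] using this
  rw [a2, b2, integral_mul_self_gaussianReal v hΦ (by fun_prop) hf'2 hΦb] at hle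
  have h0 : ∫ x, x ∂γ = 0 := integral_id_gaussianReal
  rw [h0] at hle
  simp only [sq]
  simp only [sq] at hle
  linarith

theorem integrable_of_abs_le {α : Type*} [MeasurableSpace α] {μ : Measure α} [IsFiniteMeasure μ]
    {f : α → ℝ} {C : ℝ} (hf : StronglyMeasurable f) (hC : ∀ x, |f x| ≤ C) : Integrable f μ :=
  Integrable.of_bound hf.aestronglyMeasurable C (ae_of_all _ fun x => by simpa using hC x)

theorem abs_integral_le_of_abs_le {α : Type*} [MeasurableSpace α] {μ : Measure α}
    [IsProbabilityMeasure μ] {f : α → ℝ} {C : ℝ} (hC : ∀ x, |f x| ≤ C) : |∫ x, f x ∂μ| ≤ C := by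
  simpa using norm_integral_le_of_norm_le_const (μ := μ) (f := f) (C := C)
    (ae_of_all _ fun x => by simpa using hC x)

theorem abs_mul_le_mul_self {a b C : ℝ} (ha : |a| ≤ C) (hb : |b| ≤ C) : |a * b| ≤ C * C := by
  rw [abs_mul]
  exact mul_le_mul ha hb (abs_nonneg _) ((abs_nonneg _).trans ha)

/-- **Efron–Stein inequality** for a bounded function on a product of two probability spaces. -/
theorem variance_prod_le {α β : Type*} [MeasurableSpace α] [MeasurableSpace β] (μ : Measure α)
    (ν : Measure β) [IsProbabilityMeasure μ] [IsProbabilityMeasure ν] {F : α × β → ℝ} {C : ℝ}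
    (hF : StronglyMeasurable F) (hC : ∀ z, |F z| ≤ C) :
    ∫ z, F z ^ 2 ∂(μ.prod ν) - (∫ z, F z ∂(μ.prod ν)) ^ 2 ≤
      ∫ a, (∫ b, F (a, b) ^ 2 ∂ν - (∫ b, F (a, b) ∂ν) ^ 2) ∂μ +
        ∫ b, (∫ a, F (a, b) ^ 2 ∂μ - (∫ a, F (a, b) ∂μ) ^ 2) ∂ν := by
  set G : α → ℝ := fun a => ∫ b, F (a, b) ∂ν
  set H : β → ℝ := fun b => ∫ a, F (a, b) ∂μ
  have hG : StronglyMeasurable G := hF.integral_prod_right'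
  have hH : StronglyMeasurable H := hF.integral_prod_left'
  have hGC : ∀ a, |G a| ≤ C := fun a => abs_integral_le_of_abs_le fun b => hC _
  have hHC : ∀ b, |H b| ≤ C := fun b => abs_integral_le_of_abs_le fun a => hC _
  have hG1 : StronglyMeasurable fun z : α × β => G z.1 := hG.comp_measurable measurable_fst
  have hH2 : StronglyMeasurable fun z : α × β => H z.2 := hH.comp_measurable measurable_snd
  have iF : Integrable F (μ.prod ν) := integrable_of_abs_le hF hC
  have iG : Integrable G μ := integrable_of_abs_le hG hGC
  have iH : Integrable H ν := integrable_of_abs_le hH hHC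
  have iFF : Integrable (fun z => F z * F z) (μ.prod ν) :=
    integrable_of_abs_le (hF.mul hF) fun z => abs_mul_le_mul_self (hC z) (hC z)
  have iFG : Integrable (fun z => F z * G z.1) (μ.prod ν) :=
    integrable_of_abs_le (hF.mul hG1) fun z => abs_mul_le_mul_self (hC z) (hGC _)
  have iFH : Integrable (fun z => F z * H z.2) (μ.prod ν) :=
    integrable_of_abs_le (hF.mul hH2) fun z => abs_mul_le_mul_self (hC z) (hHC _)
  have iGG : Integrable (fun a => G a * G a) μ :=
    integrable_of_abs_le (hG.mul hG) fun z => abs_mul_le_mul_self (hGC z) (hGC z)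
  have iHH : Integrable (fun b => H b * H b) ν :=
    integrable_of_abs_le (hH.mul hH) fun z => abs_mul_le_mul_self (hHC z) (hHC z)
  set m := ∫ z, F z ∂(μ.prod ν)
  have mG : ∫ a, G a ∂μ = m := (integral_prod F iF).symm
  have mH : ∫ b, H b ∂ν = m := (integral_prod_symm F iF).symm
  have eFG : ∫ z, F z * G z.1 ∂(μ.prod ν) = ∫ a, G a * G a ∂μ := by
    rw [integral_prod _ iFG]
    simp only [integral_mul_const]
    rfl
  have eFH : ∫ z, F z * H z.2 ∂(μ.prod ν) = ∫ b, H b * H b ∂ν := by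
    rw [integral_prod_symm _ iFH]
    simp only [integral_mul_const]
    rfl
  have eFF1 : ∫ a, (∫ b, F (a, b) ^ 2 ∂ν - G a ^ 2) ∂μ =
      ∫ z, F z * F z ∂(μ.prod ν) - ∫ a, G a * G a ∂μ := by
    simp only [sq]
    rw [integral_sub iFF.integral_prod_left iGG, integral_prod _ iFF]
  have eFF2 : ∫ b, (∫ a, F (a, b) ^ 2 ∂μ - H b ^ 2) ∂ν =
      ∫ z, F z * F z ∂(μ.prod ν) - ∫ b, H b * H b ∂ν := by
    simp only [sq]
    rw [integral_sub iFF.integral_prod_right iHH, integral_prod_symm _ iFF]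
  have iK : Integrable (fun z : α × β => G z.1 * H z.2) (μ.prod ν) := iG.mul_prod iH
  have iG1 : Integrable (fun z : α × β => G z.1) (μ.prod ν) := iG.comp_fst ν
  have iH2 : Integrable (fun z : α × β => H z.2) (μ.prod ν) := iH.comp_snd μ
  have iGG1 : Integrable (fun z : α × β => G z.1 * G z.1) (μ.prod ν) := iGG.comp_fst ν
  have iHH2 : Integrable (fun z : α × β => H z.2 * H z.2) (μ.prod ν) := iHH.comp_snd μ
  -- The integrand is the square of the interaction term of the Hoeffding decomposition. Its
  -- nonnegativity is exactly the claim.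
  have key : 0 ≤ ∫ z, (F z - G z.1 - H z.2 + m) ^ 2 ∂(μ.prod ν) :=
    integral_nonneg fun z => sq_nonneg _
  have expand : ∫ z, (F z - G z.1 - H z.2 + m) ^ 2 ∂(μ.prod ν) =
      ∫ z, F z * F z ∂(μ.prod ν) + ∫ z, G z.1 * G z.1 ∂(μ.prod ν)
        + ∫ z, H z.2 * H z.2 ∂(μ.prod ν) - 2 * ∫ z, F z * G z.1 ∂(μ.prod ν)
        - 2 * ∫ z, F z * H z.2 ∂(μ.prod ν) + 2 * ∫ z, G z.1 * H z.2 ∂(μ.prod ν)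
        + 2 * m * ∫ z, F z ∂(μ.prod ν) - 2 * m * ∫ z, G z.1 ∂(μ.prod ν)
        - 2 * m * ∫ z, H z.2 ∂(μ.prod ν) + m ^ 2 := by
    simp only [← integral_const_mul]
    have j1 := iFF.add iGG1
    have j2 := j1.add iHH2
    have j3 := j2.sub (iFG.const_mul 2)
    have j4 := j3.sub (iFH.const_mul 2)
    have j5 := j4.add (iK.const_mul 2)
    have j6 := j5.add (iF.const_mul (2 * m))
    have j7 := j6.sub (iG1.const_mul (2 * m))
    have j8 := j7.sub (iH2.const_mul (2 * m))
    rw [← integral_add' iFF iGG1, ← integral_add' j1 iHH2, ← integral_sub' j2 (iFG.const_mul 2),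
      ← integral_sub' j3 (iFH.const_mul 2), ← integral_add' j4 (iK.const_mul 2),
      ← integral_add' j5 (iF.const_mul (2 * m)), ← integral_sub' j6 (iG1.const_mul (2 * m)),
      ← integral_sub' j7 (iH2.const_mul (2 * m))]
    have : m ^ 2 = ∫ _z : α × β, m ^ 2 ∂(μ.prod ν) := by simp
    rw [this, ← integral_add' j8 (integrable_const _)]
    refine integral_congr_ae (ae_of_all _ fun z => ?_)
    simp only [Pi.add_apply, Pi.sub_apply]
    ring
  rw [expand, eFG, eFH, integral_fun_fst (fun a => G a * G a), integral_fun_snd (fun b => H b * H b),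
    integral_prod_mul, integral_fun_fst G, integral_fun_snd H, mG, mH] at key
  rw [eFF1, eFF2]
  simp only [sq]
  simp only [sq, probReal_univ, one_smul] at key
  change 0 ≤ _ + _ + _ - _ - _ + _ + 2 * m * m - _ - _ + _ at key
  linarith

/-- **Gaussian Poincaré inequality** in dimension `n`. -/
theorem gaussian_poincare_fin (v : ℝ≥0) : ∀ (n : ℕ) (F : (Fin n → ℝ) → ℝ)
    (F' : Fin n → (Fin n → ℝ) → ℝ) (C : ℝ), Continuous F → (∀ x, |F x| ≤ C) →
    (∀ k, Continuous (F' k)) → (∀ k x, |F' k x| ≤ C) →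
    (∀ x k, HasDerivAt (fun s => F (Function.update x k s)) (F' k x) (x k)) →
    ∫ x, F x ^ 2 ∂(Measure.pi fun _ => gaussianReal 0 v) -
      (∫ x, F x ∂(Measure.pi fun _ => gaussianReal 0 v)) ^ 2 ≤
      v * ∑ k, ∫ x, F' k x ^ 2 ∂(Measure.pi fun _ => gaussianReal 0 v) := by
  intro n
  induction n with
  | zero =>
    intro F F' C _ _ _ _ _
    have : ∀ x, F x = F default := fun x => congrArg F (Subsingleton.elim _ _)
    simp [this]
  | succ n ih =>
    intro F F' C hFc hFb hF'c hF'b hF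
    set γ := gaussianReal 0 v
    set π := Measure.pi fun _ : Fin n => γ
    have hmp := (measurePreserving_piFinSuccAbove (fun _ : Fin (n + 1) => γ) 0).symm
    have tr : ∀ f : (Fin (n + 1) → ℝ) → ℝ, ∫ x, f x ∂(Measure.pi fun _ => γ) =
        ∫ z : ℝ × (Fin n → ℝ), f (Fin.cons z.1 z.2) ∂(γ.prod π) := by
      intro f
      rw [← hmp.integral_comp']
      refine integral_congr_ae (ae_of_all _ fun z => ?_)
      change f (Fin.insertNth 0 z.1 z.2) = _
      rw [Fin.insertNth_zero]
      rfl
    have hcc : Continuous fun z : ℝ × (Fin n → ℝ) => (Fin.cons z.1 z.2 : Fin (n + 1) → ℝ) := by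
      fun_prop
    have h0 : ∀ a (b : Fin n → ℝ), HasDerivAt (fun s => F (Fin.cons s b))
        (F' 0 (Fin.cons a b)) a := by
      intro a b
      simpa [Fin.update_cons_zero] using hF (Fin.cons a b) 0
    have hs : ∀ a (b : Fin n → ℝ) k, HasDerivAt
        (fun s => F (Fin.cons a (Function.update b k s))) (F' k.succ (Fin.cons a b)) (b k) := by
      intro a b k
      have := hF (Fin.cons a b) k.succ
      simpa [Fin.cons_update] using this
    have iF' : ∀ k, Integrable (fun z : ℝ × (Fin n → ℝ) => F' k (Fin.cons z.1 z.2) ^ 2)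
        (γ.prod π) := by
      intro k
      refine integrable_of_abs_le (C := C ^ 2)
        (((hF'c k).comp hcc).pow 2).stronglyMeasurable fun z => ?_
      rw [abs_pow]; gcongr; exact hF'b _ _
    rw [tr, tr]
    have hFm : StronglyMeasurable fun z : ℝ × (Fin n → ℝ) => F (Fin.cons z.1 z.2) :=
      (hFc.comp hcc).stronglyMeasurable
    have iFF : Integrable (fun z : ℝ × (Fin n → ℝ) => F (Fin.cons z.1 z.2) ^ 2) (γ.prod π) := by
      refine integrable_of_abs_le (C := C ^ 2) (hFm.pow 2) fun z => ?_
      rw [abs_pow]; gcongr; exact hFb _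
    have iG : Integrable (fun a => (∫ b, F (Fin.cons a b) ∂π) ^ 2) γ := by
      refine integrable_of_abs_le (C := C ^ 2) (hFm.integral_prod_right'.pow 2) fun z => ?_
      rw [abs_pow]; gcongr; exact abs_integral_le_of_abs_le fun b => hFb _
    have iH : Integrable (fun b => (∫ a, F (Fin.cons a b) ∂γ) ^ 2) π := by
      refine integrable_of_abs_le (C := C ^ 2) (hFm.integral_prod_left'.pow 2) fun z => ?_
      rw [abs_pow]; gcongr; exact abs_integral_le_of_abs_le fun b => hFb _
    -- Efron–Stein separates the first coordinate: the one-dimensional inequality treats it, the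
    -- induction hypothesis the others.
    refine (variance_prod_le γ π hFm fun z => hFb _).trans ?_
    rw [Fin.sum_univ_succ, mul_add, add_comm]
    refine add_le_add ?_ ?_
    · rw [tr, integral_prod_symm _ (iF' 0), ← integral_const_mul]
      refine integral_mono (iFF.integral_prod_right.sub iH) ((iF' 0).integral_prod_right.const_mul _)
        fun b => ?_
      exact gaussian_poincare_real v (h0 · b) (fun _ => hFb _)
        ((hF'c 0).comp (hcc.comp (by fun_prop : Continuous fun a : ℝ => (a, b)))) (fun _ => hF'b _ _)
    · simp only [tr]
      simp only [fun k : Fin n => integral_prod _ (iF' k.succ)]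
      rw [← integral_finsetSum _ (fun k _ => (iF' k.succ).integral_prod_left), ← integral_const_mul]
      refine integral_mono (iFF.integral_prod_left.sub iG)
        ((integrable_finsetSum _ fun k _ => (iF' k.succ).integral_prod_left).const_mul _) fun a => ?_
      have hca : Continuous fun b : Fin n → ℝ => (Fin.cons a b : Fin (n + 1) → ℝ) :=
        hcc.comp (by fun_prop : Continuous fun b : Fin n → ℝ => (a, b))
      exact ih (fun b => F (Fin.cons a b)) (fun k b => F' k.succ (Fin.cons a b)) C
        (hFc.comp hca) (fun _ => hFb _) (fun k => (hF'c _).comp hca) (fun _ _ => hF'b _ _)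
        (fun b k => hs a b k)

/-- **Gaussian Poincaré inequality** for a finite family of independent variables. -/
theorem gaussian_poincare {ι : Type*} [Fintype ι] [DecidableEq ι] (v : ℝ≥0) {F : (ι → ℝ) → ℝ}
    {F' : ι → (ι → ℝ) → ℝ} {C : ℝ} (hFc : Continuous F) (hFb : ∀ x, |F x| ≤ C)
    (hF'c : ∀ k, Continuous (F' k)) (hF'b : ∀ k x, |F' k x| ≤ C)
    (hF : ∀ x k, HasDerivAt (fun s => F (Function.update x k s)) (F' k x) (x k)) :
    ∫ x, F x ^ 2 ∂(Measure.pi fun _ => gaussianReal 0 v) -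
      (∫ x, F x ∂(Measure.pi fun _ => gaussianReal 0 v)) ^ 2 ≤
      v * ∑ k, ∫ x, F' k x ^ 2 ∂(Measure.pi fun _ => gaussianReal 0 v) := by
  set γ := gaussianReal 0 v
  set e := Fintype.equivFin ι
  have hmp := measurePreserving_piCongrLeft (fun _ : ι => γ) e.symm
  have hap : ∀ y : Fin (Fintype.card ι) → ℝ,
      (MeasurableEquiv.piCongrLeft (fun _ : ι => ℝ) e.symm) y = y ∘ e := by
    intro y
    ext i
    have := Equiv.piCongrLeft_apply_apply (fun _ : ι => ℝ) e.symm y (e i)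
    simpa [MeasurableEquiv.coe_piCongrLeft] using this
  have tr : ∀ f : (ι → ℝ) → ℝ, ∫ x, f x ∂(Measure.pi fun _ => γ) =
      ∫ y : Fin (Fintype.card ι) → ℝ, f (y ∘ e) ∂(Measure.pi fun _ => γ) := by
    intro f
    rw [← hmp.integral_comp']
    simp only [hap]
  have hce : Continuous fun y : Fin (Fintype.card ι) → ℝ => y ∘ e := by fun_prop
  rw [tr, tr]
  have := gaussian_poincare_fin v (Fintype.card ι) (fun y => F (y ∘ e))
    (fun k y => F' (e.symm k) (y ∘ e)) C (hFc.comp hce) (fun _ => hFb _)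
    (fun k => (hF'c _).comp hce) (fun _ _ => hF'b _ _) (fun y k => by
      have h := hF (y ∘ e) (e.symm k)
      have hu : ∀ s, Function.update y k s ∘ e = Function.update (y ∘ e) (e.symm k) s := by
        intro s
        ext i
        simp [Function.update_apply, Equiv.eq_symm_apply]
      simpa [hu] using h)
  refine this.trans (le_of_eq ?_)
  congr 1
  rw [← e.symm.sum_comp (fun k => ∫ x, F' k x ^ 2 ∂(Measure.pi fun _ => γ))]
  exact Finset.sum_congr rfl fun k _ => (tr fun x => F' (e.symm k) x ^ 2).symm

/-! ### Higher moments of odd functions of Gaussian variables -/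

theorem hasDerivAt_mul_abs_rpow {q : ℝ} (hq : 1 < q) (r : ℝ) :
    HasDerivAt (fun r : ℝ => r * |r| ^ (q - 1)) (q * |r| ^ (q - 1)) r := by
  have hq0 : 0 < q - 1 := by linarith
  rcases lt_trichotomy r 0 with h | rfl | h
  · have h1 : HasDerivAt (fun r : ℝ => |r|) (-1) r := hasDerivAt_abs_neg h
    have h2 := (hasDerivAt_id r).mul (h1.rpow_const (p := q - 1) (Or.inl (abs_pos.2 h.ne).ne'))
    refine h2.congr_deriv ?_
    have h3 : |r| ^ (q - 1) = |r| ^ (q - 1 - 1) * |r| := by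
      rw [← Real.rpow_add_one (abs_pos.2 h.ne).ne']; ring_nf
    have h4 : |r| = -r := abs_of_neg h
    rw [h3, id]
    generalize |r| ^ (q - 1 - 1) = y
    rw [h4]
    ring
  · rw [hasDerivAt_iff_tendsto_slope]
    have hc : Continuous fun r : ℝ => |r| ^ (q - 1) :=
      continuous_abs.rpow_const fun _ => Or.inr hq0.le
    have h0 := (hc.tendsto 0).mono_left (nhdsWithin_le_nhds (s := {0}ᶜ))
    simp only [abs_zero, Real.zero_rpow hq0.ne', mul_zero] at h0 ⊢
    refine h0.congr' ?_
    filter_upwards [self_mem_nhdsWithin] with x hx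
    have hx' : x ≠ 0 := hx
    simp only [slope, sub_zero, vsub_eq_sub, smul_eq_mul, zero_mul]
    field_simp
  · have h1 : HasDerivAt (fun r : ℝ => |r|) 1 r := hasDerivAt_abs_pos h
    have h2 := (hasDerivAt_id r).mul (h1.rpow_const (p := q - 1) (Or.inl (abs_pos.2 h.ne').ne'))
    refine h2.congr_deriv ?_
    have h3 : |r| ^ (q - 1) = |r| ^ (q - 1 - 1) * |r| := by
      rw [← Real.rpow_add_one (abs_pos.2 h.ne').ne']; ring_nf
    have h4 : |r| = r := abs_of_pos h
    rw [h3, id]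
    generalize |r| ^ (q - 1 - 1) = y
    rw [h4]
    ring

instance isNegInvariant_gaussianReal (v : ℝ≥0) : (gaussianReal 0 v).IsNegInvariant :=
  ⟨by rw [Measure.neg, show (Neg.neg : ℝ → ℝ) = fun x => -x from rfl, gaussianReal_map_neg,
    neg_zero]⟩

/-- An `L^{2q}` version of the Poincaré inequality for odd functions of independent centred
Gaussian variables; the constant is sharp as `q → 1`. -/
theorem integral_abs_rpow_le_of_odd {ι : Type*} [Fintype ι] [DecidableEq ι] (v : ℝ≥0) {q : ℝ}
    (hq : 1 < q) {u : (ι → ℝ) → ℝ} {u' : ι → (ι → ℝ) → ℝ} {C : ℝ} (huc : Continuous u)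
    (hub : ∀ x, |u x| ≤ C) (hodd : ∀ x, u (-x) = -u x) (hu'c : ∀ k, Continuous (u' k))
    (hu'b : ∀ k x, |u' k x| ≤ C)
    (hu : ∀ x k, HasDerivAt (fun s => u (Function.update x k s)) (u' k x) (x k)) :
    ∫ x, |u x| ^ (2 * q) ∂(Measure.pi fun _ => gaussianReal 0 v) ≤
      (v * q ^ 2) ^ q *
        ∫ x, (∑ k, u' k x ^ 2) ^ q ∂(Measure.pi fun _ => gaussianReal 0 v) := by
  set π := Measure.pi fun _ : ι => gaussianReal 0 v
  have hC : 0 ≤ C := (abs_nonneg _).trans (hub 0)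
  have hq0 : 0 < q - 1 := by linarith
  have habs : Continuous fun x => |u x| ^ (q - 1) :=
    huc.abs.rpow_const fun _ => Or.inr hq0.le
  have habsb : ∀ x, |u x| ^ (q - 1) ≤ C ^ (q - 1) := fun x =>
    Real.rpow_le_rpow (abs_nonneg _) (hub x) hq0.le
  have habs0 : ∀ x, 0 ≤ |u x| ^ (q - 1) := fun x => Real.rpow_nonneg (abs_nonneg _) _
  -- `w` is the signed power of `u`: it is differentiable even where `u` vanishes, it is odd, hence
  -- centred, and `w² = |u|^(2q)`.
  set w : (ι → ℝ) → ℝ := fun x => u x * |u x| ^ (q - 1)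
  set w' : ι → (ι → ℝ) → ℝ := fun k x => q * |u x| ^ (q - 1) * u' k x
  have hwsq : ∀ x, w x ^ 2 = |u x| ^ (2 * q) := by
    intro x
    have h1 : (2 * q) = 2 + ((q - 1) + (q - 1)) := by ring
    rw [h1, Real.rpow_add_of_nonneg (abs_nonneg _) (by norm_num) (by linarith),
      Real.rpow_add_of_nonneg (abs_nonneg _) hq0.le hq0.le, Real.rpow_two, sq_abs]
    simp only [w]
    ring
  set G : (ι → ℝ) → ℝ := fun x => ∑ k, u' k x ^ 2
  have hG0 : ∀ x, 0 ≤ G x := fun x => Finset.sum_nonneg fun k _ => sq_nonneg _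
  have hGc : Continuous G := by fun_prop
  have hGb : ∀ x, G x ≤ Fintype.card ι * C ^ 2 := by
    intro x
    calc G x ≤ ∑ _k : ι, C ^ 2 := Finset.sum_le_sum fun k _ => by
          rw [← sq_abs]; gcongr; exact hu'b k x
      _ = _ := by simp
  have hw0 : ∫ x, w x ∂π = 0 := by
    have h1 : ∫ x, w (-x) ∂π = ∫ x, w x ∂π := integral_neg_eq_self w π
    have h2 : ∀ x, w (-x) = -w x := fun x => by simp [w, hodd]
    simp only [h2, integral_neg] at h1
    linarith
  have hP := gaussian_poincare (F := w) (F' := w') v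
    (C := C * C ^ (q - 1) + q * C ^ (q - 1) * C) (huc.mul habs) (fun x => by
      have : |w x| ≤ C * C ^ (q - 1) := by
        rw [abs_mul, abs_of_nonneg (habs0 x)]
        exact mul_le_mul (hub x) (habsb x) (habs0 x) hC
      have : 0 ≤ q * C ^ (q - 1) * C := by positivity
      linarith) (fun k => ((continuous_const.mul habs).mul (hu'c k))) (fun k x => by
      have : |w' k x| ≤ q * C ^ (q - 1) * C := by
        rw [abs_mul, abs_mul, abs_of_nonneg (habs0 x), abs_of_pos (by linarith : 0 < q)]
        exact mul_le_mul (mul_le_mul_of_nonneg_left (habsb x) (by linarith)) (hu'b k x)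
          (abs_nonneg _) (by positivity)
      have : 0 ≤ C * C ^ (q - 1) := by positivity
      linarith) (fun x k => by
      have h1 : HasDerivAt (fun r : ℝ => r * |r| ^ (q - 1)) (q * |u x| ^ (q - 1))
          (u (Function.update x k (x k))) := by
        rw [Function.update_eq_self]; exact hasDerivAt_mul_abs_rpow hq (u x)
      exact h1.comp (x k) (hu x k))
  rw [hw0] at hP
  simp only [hwsq] at hP
  have i1 : Integrable (fun x => |u x| ^ (2 * q)) π := by
    refine integrable_of_abs_le (C := C ^ (2 * q))
      (huc.abs.rpow_const fun _ => Or.inr (by linarith)).stronglyMeasurable fun x => ?_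
    rw [abs_of_nonneg (by positivity)]
    exact Real.rpow_le_rpow (abs_nonneg _) (hub x) (by linarith)
  have i2 : Integrable (fun x => G x ^ q) π := by
    refine integrable_of_abs_le (C := (Fintype.card ι * C ^ 2) ^ q)
      (hGc.rpow_const fun _ => Or.inr (by linarith)).stronglyMeasurable fun x => ?_
    rw [abs_of_nonneg (Real.rpow_nonneg (hG0 x) _)]
    exact Real.rpow_le_rpow (hG0 x) (hGb x) (by linarith)
  have i3 : ∀ k, Integrable (fun x => w' k x ^ 2) π := by
    intro k
    refine integrable_of_abs_le (C := (q * C ^ (q - 1) * C) ^ 2)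
      (((continuous_const.mul habs).mul (hu'c k)).pow 2).stronglyMeasurable fun x => ?_
    rw [abs_pow, abs_mul, abs_mul, abs_of_nonneg (habs0 x), abs_of_pos (by linarith : 0 < q)]
    have := hu'b k x
    have := habsb x
    gcongr
  rw [← integral_finsetSum _ (fun k _ => i3 k), ← integral_const_mul] at hP
  have hconj : (q / (q - 1)).HolderConjugate q := by
    rw [Real.holderConjugate_iff]
    refine ⟨by rw [lt_div_iff₀ hq0]; linarith, ?_⟩
    field_simp
    ring
  -- Young with exponents `q/(q-1)` and `q` splits `|u|^(2(q-1)) · v q² G`. The first part is the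
  -- fraction `(q-1)/q` of `|u|^(2q)`, to be absorbed on the left.
  have hyoung : ∀ x, v * ∑ k, w' k x ^ 2 ≤
      |u x| ^ (2 * q) * ((q - 1) / q) + (v * q ^ 2) ^ q / q * G x ^ q := by
    intro x
    have h1 : v * ∑ k, w' k x ^ 2 = |u x| ^ (2 * (q - 1)) * (v * q ^ 2 * G x) := by
      have : |u x| ^ (2 * (q - 1)) = |u x| ^ (q - 1) * |u x| ^ (q - 1) := by
        rw [← Real.rpow_add_of_nonneg (abs_nonneg _) hq0.le hq0.le]; ring_nf
      simp only [w', G, mul_pow, ← Finset.mul_sum, this]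
      ring
    have h2 := Real.young_inequality_of_nonneg (a := |u x| ^ (2 * (q - 1)))
      (b := v * q ^ 2 * G x) (by positivity) (mul_nonneg (by positivity) (hG0 x)) hconj
    rw [h1]
    refine h2.trans (le_of_eq ?_)
    rw [← Real.rpow_mul (abs_nonneg _), Real.mul_rpow (by positivity) (hG0 x)]
    have e : 2 * (q - 1) * (q / (q - 1)) = 2 * q := by field_simp
    rw [e]
    field_simp
  have h3 := integral_mono (μ := π) ((integrable_finsetSum _ fun k _ => i3 k).const_mul _)
    ((i1.mul_const ((q - 1) / q)).add (i2.const_mul ((v * q ^ 2) ^ q / q))) hyoung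
  simp only [Pi.add_apply] at h3
  rw [integral_add (i1.mul_const _) (i2.const_mul _), integral_mul_const,
    integral_const_mul ((v * q ^ 2) ^ q / q)] at h3
  have hqp : 0 < q := by linarith
  have h4 := hP.trans h3
  set A := ∫ x, |u x| ^ (2 * q) ∂π
  set B := ∫ x, G x ^ q ∂π
  have h5 : A ≤ A * ((q - 1) / q) + (v * q ^ 2) ^ q / q * B := by linarith
  have h6 : A * ((q - 1) / q) + (v * q ^ 2) ^ q / q * B = A + ((v * q ^ 2) ^ q * B - A) / q := by
    field_simp
    ring
  rw [h6] at h5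
  have h7 : 0 ≤ ((v * q ^ 2) ^ q * B - A) / q := by linarith
  have h8 : 0 ≤ (v * q ^ 2) ^ q * B - A := by
    by_contra h
    exact absurd h7 (not_le.2 (div_neg_of_neg_of_pos (not_le.1 h) hqp))
  linarith

/-! ### Gibbs averages and the removal of one spin -/

section Ising

variable {V : Type*} [Fintype V] [DecidableEq V]

/-- The energy of a spin configuration with interactions `U` and external field `h`. -/
noncomputable def energy (U : V → V → ℝ) (h : V → ℝ) (σ : V → ℤˣ) : ℝ :=
  (∑ k, ∑ l, U k l * spin (σ k) * spin (σ l)) + ∑ k, h k * spin (σ k)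

/-- The unnormalized Gibbs average. -/
noncomputable def gibbsSum (U : V → V → ℝ) (h : V → ℝ) (f : (V → ℤˣ) → ℝ) : ℝ :=
  ∑ σ : V → ℤˣ, f σ * Real.exp (energy U h σ)

/-- The Gibbs average of the observable `f`. -/
noncomputable def gibbsAvg (U : V → V → ℝ) (h : V → ℝ) (f : (V → ℤˣ) → ℝ) : ℝ :=
  gibbsSum U h f / gibbsSum U h fun _ => 1

/-- The magnetization at the site `j`. -/
noncomputable def mag (U : V → V → ℝ) (h : V → ℝ) (j : V) : ℝ :=
  gibbsAvg U h fun σ => spin (σ j)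

/-- The truncated two-point function. -/
noncomputable def corr (U : V → V → ℝ) (h : V → ℝ) (i j : V) : ℝ :=
  gibbsAvg U h (fun σ => spin (σ i) * spin (σ j)) - mag U h i * mag U h j

/-- The interactions with the site `i` removed. -/
def removeSite (U : V → V → ℝ) (i : V) : V → V → ℝ :=
  fun k l => if k = i ∨ l = i then 0 else U k l

/-- The field which the spin at `i`, when equal to `1`, exerts on the other sites. -/
def siteField (U : V → V → ℝ) (i : V) : V → ℝ := fun k => if k = i then 0 else U i k + U k i

@[simp] theorem spin_one : spin 1 = 1 := by simp [spin]

@[simp] theorem spin_neg_one : spin (-1) = -1 := by simp [spin]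

theorem spin_mul_self (s : ℤˣ) : spin s * spin s = 1 := by
  rcases Int.units_eq_one_or s with rfl | rfl <;> simp

theorem abs_spin (s : ℤˣ) : |spin s| = 1 := by
  rcases Int.units_eq_one_or s with rfl | rfl <;> simp

theorem gibbsSum_one_pos (U : V → V → ℝ) (h : V → ℝ) : 0 < gibbsSum U h fun _ => 1 :=
  Finset.sum_pos (fun _ _ => by positivity) Finset.univ_nonempty

theorem abs_gibbsAvg_le (U : V → V → ℝ) (h : V → ℝ) {f : (V → ℤˣ) → ℝ} (hf : ∀ σ, |f σ| ≤ 1) :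
    |gibbsAvg U h f| ≤ 1 := by
  rw [gibbsAvg, abs_div, abs_of_pos (gibbsSum_one_pos U h), div_le_one (gibbsSum_one_pos U h)]
  refine (Finset.abs_sum_le_sum_abs _ _).trans (Finset.sum_le_sum fun σ _ => ?_)
  rw [abs_mul, Real.abs_exp]
  gcongr
  exact hf σ

theorem abs_mag_le (U : V → V → ℝ) (h : V → ℝ) (j : V) : |mag U h j| ≤ 1 :=
  abs_gibbsAvg_le U h fun _ => (abs_spin _).le

theorem abs_corr_le (U : V → V → ℝ) (h : V → ℝ) (i j : V) : |corr U h i j| ≤ 2 := by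
  have h1 : |gibbsAvg U h (fun σ => spin (σ i) * spin (σ j))| ≤ 1 :=
    abs_gibbsAvg_le U h fun σ => by rw [abs_mul, abs_spin, abs_spin, one_mul]
  have h2 : |mag U h i * mag U h j| ≤ 1 := by
    rw [abs_mul]
    exact mul_le_one₀ (abs_mag_le U h i) (abs_nonneg _) (abs_mag_le U h j)
  exact (abs_sub _ _).trans (by linarith)

theorem continuous_gibbsSum (f : (V → ℤˣ) → ℝ) :
    Continuous fun z : (V → V → ℝ) × (V → ℝ) => gibbsSum z.1 z.2 f := by
  unfold gibbsSum energy
  fun_prop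

theorem continuous_gibbsAvg (f : (V → ℤˣ) → ℝ) :
    Continuous fun z : (V → V → ℝ) × (V → ℝ) => gibbsAvg z.1 z.2 f :=
  (continuous_gibbsSum f).div (continuous_gibbsSum _) fun z => (gibbsSum_one_pos z.1 z.2).ne'

theorem continuous_mag (j : V) :
    Continuous fun z : (V → V → ℝ) × (V → ℝ) => mag z.1 z.2 j :=
  continuous_gibbsAvg _

theorem continuous_corr (i j : V) :
    Continuous fun z : (V → V → ℝ) × (V → ℝ) => corr z.1 z.2 i j :=
  (continuous_gibbsAvg _).sub ((continuous_mag i).mul (continuous_mag j))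

theorem continuous_mag_comp {X : Type*} [TopologicalSpace X] {U : X → V → V → ℝ} {h : X → V → ℝ}
    (hU : Continuous U) (hh : Continuous h) (j : V) : Continuous fun z => mag (U z) (h z) j := by
  have := (continuous_mag j).comp (hU.prodMk hh)
  exact this

theorem continuous_corr_comp {X : Type*} [TopologicalSpace X] {U : X → V → V → ℝ} {h : X → V → ℝ}
    (hU : Continuous U) (hh : Continuous h) (i j : V) :
    Continuous fun z => corr (U z) (h z) i j := by
  have := (continuous_corr i j).comp (hU.prodMk hh)
  exact this

/-- The derivative of the unnormalized Gibbs average with respect to the external field. -/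
theorem hasDerivAt_gibbsSum (U : V → V → ℝ) {η : ℝ → V → ℝ} {η' : V → ℝ} {s : ℝ}
    (hη : ∀ k, HasDerivAt (fun s => η s k) (η' k) s) (f : (V → ℤˣ) → ℝ) :
    HasDerivAt (fun s => gibbsSum U (η s) f)
      (∑ k, η' k * gibbsSum U (η s) fun σ => f σ * spin (σ k)) s := by
  have h1 : ∀ σ : V → ℤˣ, HasDerivAt (fun s => energy U (η s) σ) (∑ k, η' k * spin (σ k)) s :=
    fun σ => (HasDerivAt.fun_sum fun k _ => (hη k).mul_const _).const_add _
  have h2 : HasDerivAt (fun s => gibbsSum U (η s) f)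
      (∑ σ : V → ℤˣ, f σ * (Real.exp (energy U (η s) σ) * ∑ k, η' k * spin (σ k))) s :=
    HasDerivAt.fun_sum fun σ _ => ((h1 σ).exp.const_mul (f σ))
  refine h2.congr_deriv ?_
  simp only [gibbsSum, Finset.mul_sum]
  rw [Finset.sum_comm]
  refine Finset.sum_congr rfl fun k _ => Finset.sum_congr rfl fun σ _ => ?_
  ring

/-- The derivatives of the magnetization with respect to the external field are the truncated
two-point functions. -/
theorem hasDerivAt_mag (U : V → V → ℝ) {η : ℝ → V → ℝ} {η' : V → ℝ} {s : ℝ}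
    (hη : ∀ k, HasDerivAt (fun s => η s k) (η' k) s) (j : V) :
    HasDerivAt (fun s => mag U (η s) j) (∑ k, η' k * corr U (η s) j k) s := by
  have hZ := (gibbsSum_one_pos U (η s)).ne'
  refine ((hasDerivAt_gibbsSum U hη fun σ => spin (σ j)).div
    (hasDerivAt_gibbsSum U hη fun _ => 1) hZ).congr_deriv ?_
  simp only [corr, mag, gibbsAvg, one_mul, mul_sub, Finset.sum_sub_distrib, ← mul_div_assoc]
  rw [← Finset.sum_div]
  have : ∑ k, η' k * (gibbsSum U (η s) (fun σ => spin (σ j)) / gibbsSum U (η s) (fun _ => 1) *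
      gibbsSum U (η s) fun σ => spin (σ k)) / gibbsSum U (η s) (fun _ => 1) =
      gibbsSum U (η s) (fun σ => spin (σ j)) *
        (∑ k, η' k * gibbsSum U (η s) fun σ => spin (σ k)) / gibbsSum U (η s) (fun _ => 1) ^ 2 := by
    rw [Finset.mul_sum, Finset.sum_div]
    refine Finset.sum_congr rfl fun k _ => ?_
    field_simp
  rw [this]
  field_simp

/-- Fixing the spin at `i` by `Function.update` forgets its old value, so each configuration is
counted twice. In exchange the site set never changes type. -/
theorem two_mul_sum_eq_sum_update (i : V) (F : (V → ℤˣ) → ℝ) :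
    2 * ∑ σ, F σ = ∑ σ, F (Function.update σ i 1) + ∑ σ, F (Function.update σ i (-1)) := by
  have hflip : ∑ σ : V → ℤˣ, F (Function.update σ i (-σ i)) = ∑ σ, F σ := by
    have hinv : Function.Involutive fun σ : V → ℤˣ => Function.update σ i (-σ i) := by
      intro σ; simp
    exact Equiv.sum_comp hinv.toPerm F
  rw [two_mul]
  nth_rewrite 2 [← hflip]
  rw [← Finset.sum_add_distrib, ← Finset.sum_add_distrib]
  refine Finset.sum_congr rfl fun σ _ => ?_
  rcases Int.units_eq_one_or (σ i) with h | h
  · have : Function.update σ i 1 = σ := by rw [← h, Function.update_eq_self]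
    rw [this, h]
  · have : Function.update σ i (-1) = σ := by rw [← h, Function.update_eq_self]
    rw [this, h, neg_neg, add_comm]

/-- Once `i` is fixed, its old spin is kept as a dummy with neither interaction nor field; the real
effect of `i` is the shift of the field elsewhere and a constant. -/
theorem energy_update (U : V → V → ℝ) (h : V → ℝ) (i : V) (σ : V → ℤˣ) (s : ℤˣ) :
    energy U h (Function.update σ i s) =
      energy (removeSite U i) (Function.update (h + spin s • siteField U i) i 0) σ +
        (U i i + h i * spin s) := by
  have e1 : ∀ k l, U k l * spin (Function.update σ i s k) * spin (Function.update σ i s l) =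
      removeSite U i k l * spin (σ k) * spin (σ l) +
        (if k = i then (if l = i then U i i else U i l * spin s * spin (σ l)) else 0) +
        (if l = i then (if k = i then 0 else U k i * spin (σ k) * spin s) else 0) := by
    intro k l
    by_cases hk : k = i
    · subst hk
      by_cases hl : l = k
      · subst hl
        simp [removeSite, mul_assoc, spin_mul_self]
      · simp [removeSite, hl]
    · by_cases hl : l = i
      · subst hl
        simp [removeSite, hk]
      · simp [removeSite, hk, hl]
  have e2 : ∀ k, h k * spin (Function.update σ i s k) =
      (if k = i then h i * spin s else 0) + (if k = i then 0 else h k * spin (σ k)) := by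
    intro k
    by_cases hk : k = i
    · subst hk; simp
    · simp [hk]
  have e3 : ∑ l, (if l = i then U i i else U i l * spin s * spin (σ l)) =
      U i i + ∑ l, (if l = i then 0 else U i l * spin s * spin (σ l)) := by
    have : U i i = ∑ l, if l = i then U i i else 0 := by simp
    rw [this, ← Finset.sum_add_distrib]
    refine Finset.sum_congr rfl fun l _ => ?_
    by_cases hl : l = i <;> simp [hl]
  have e4 : ∀ k, Function.update (h + spin s • siteField U i) i 0 k * spin (σ k) =
      (if k = i then 0 else U i k * spin s * spin (σ k)) +
      (if k = i then 0 else U k i * spin (σ k) * spin s) +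
      (if k = i then 0 else h k * spin (σ k)) := by
    intro k
    by_cases hk : k = i
    · subst hk; simp
    · simp [hk, siteField]; ring
  simp only [energy, e1, e2, e4, Finset.sum_add_distrib, Finset.sum_ite_eq', Finset.mem_univ, if_true]
  have e5 : ∑ k, ∑ l, (if k = i then (if l = i then U i i else U i l * spin s * spin (σ l)) else 0)
      = ∑ l, (if l = i then U i i else U i l * spin s * spin (σ l)) := by
    rw [Finset.sum_comm]; simp
  rw [e5, e3]
  ring

theorem removeSite_removeSite {V : Type*} [DecidableEq V] (U : V → V → ℝ) (i : V) :
    removeSite (removeSite U i) i = removeSite U i := by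
  ext k l; simp +contextual [removeSite]

theorem siteField_removeSite {V : Type*} [DecidableEq V] (U : V → V → ℝ) (i : V) : siteField (removeSite U i) i = 0 := by
  ext k; simp [siteField, removeSite]

/-- The Gibbs sums conditioned on the spin at `i`. -/
theorem two_mul_gibbsSum (U : V → V → ℝ) (h : V → ℝ) (i : V) (f : (V → ℤˣ) → ℝ) :
    2 * gibbsSum U h f =
      Real.exp (U i i + h i) * gibbsSum (removeSite U i)
        (Function.update (h + siteField U i) i 0) (fun σ => f (Function.update σ i 1)) +
      Real.exp (U i i - h i) * gibbsSum (removeSite U i)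
        (Function.update (h - siteField U i) i 0) (fun σ => f (Function.update σ i (-1))) := by
  rw [gibbsSum, two_mul_sum_eq_sum_update i]
  simp only [energy_update, spin_one, spin_neg_one, one_smul, neg_smul, ← sub_eq_add_neg, mul_one,
    mul_neg, Real.exp_add, gibbsSum, Finset.mul_sum]
  congr 1 <;> refine Finset.sum_congr rfl fun σ _ => ?_
  · ring
  · ring

/-- A decoupled spin factors out of numerator and denominator, so its own field is irrelevant to the
other sites. -/
theorem mag_removeSite (U : V → V → ℝ) (h : V → ℝ) {i j : V} (hij : j ≠ i) :
    mag (removeSite U i) h j = mag (removeSite U i) (Function.update h i 0) j := by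
  have e := fun f => two_mul_gibbsSum (removeSite U i) h i f
  simp only [removeSite_removeSite, siteField_removeSite, add_zero, sub_zero] at e
  have e1 := e fun _ => 1
  have e2 := e fun σ => spin (σ j)
  simp only [Function.update_of_ne hij, ← add_mul] at e1 e2
  have hZ := (gibbsSum_one_pos (removeSite U i) h).ne'
  have hZ' := (gibbsSum_one_pos (removeSite U i) (Function.update h i 0)).ne'
  rw [mag, mag, gibbsAvg, gibbsAvg, div_eq_div_iff hZ hZ']
  have := congrArg₂ (· * ·) e1 e2
  set E := Real.exp (removeSite U i i i + h i) + Real.exp (removeSite U i i i - h i)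
  have h2 : (2 : ℝ) * (gibbsSum (removeSite U i) h (fun σ => spin (σ j)) *
      gibbsSum (removeSite U i) (Function.update h i 0) fun _ => 1) =
    2 * (gibbsSum (removeSite U i) (Function.update h i 0) (fun σ => spin (σ j)) *
      gibbsSum (removeSite U i) h fun _ => 1) := by
    linear_combination (gibbsSum (removeSite U i) (Function.update h i 0) fun _ => 1) * e2 -
      (gibbsSum (removeSite U i) (Function.update h i 0) fun σ => spin (σ j)) * e1
  linarith

/-- The truncated two-point function in terms of the effect of the spin at `i` on the
magnetization at `j`. -/
theorem corr_eq (U : V → V → ℝ) (h : V → ℝ) {i j : V} (hij : i ≠ j) :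
    corr U h i j = (1 - mag U h i ^ 2) * ((mag (removeSite U i) (h + siteField U i) j -
      mag (removeSite U i) (h - siteField U i) j) / 2) := by
  rw [mag_removeSite U (h + siteField U i) hij.symm, mag_removeSite U (h - siteField U i) hij.symm]
  have e := fun f => two_mul_gibbsSum U h i f
  have e1 := e fun _ => 1
  have e2 := e fun σ => spin (σ j)
  have e3 := e fun σ => spin (σ i)
  have e4 := e fun σ => spin (σ i) * spin (σ j)
  have hlin : ∀ (h : V → ℝ) (c : ℝ) f, gibbsSum (removeSite U i) h (fun σ => c * f σ) =
      c * gibbsSum (removeSite U i) h f := fun h c f => by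
    simp only [gibbsSum, Finset.mul_sum, mul_assoc]
  have hlin1 : ∀ (h : V → ℝ) (c : ℝ), gibbsSum (removeSite U i) h (fun _ => c) =
      c * gibbsSum (removeSite U i) h fun _ => 1 := fun h c => by
    simpa using hlin h c fun _ => 1
  simp only [Function.update_of_ne hij.symm, Function.update_self, spin_one, spin_neg_one] at e2 e3 e4
  rw [hlin1 _ (-1)] at e3
  rw [hlin, hlin] at e4
  have hZ := gibbsSum_one_pos U h
  have hP := gibbsSum_one_pos (removeSite U i) (Function.update (h + siteField U i) i 0)
  have hM := gibbsSum_one_pos (removeSite U i) (Function.update (h - siteField U i) i 0)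
  have hep := Real.exp_pos (U i i + h i)
  have hem := Real.exp_pos (U i i - h i)
  simp only [corr, mag, gibbsAvg]
  set Z := gibbsSum U h fun _ => 1
  set S := gibbsSum U h fun σ => spin (σ j)
  set T := gibbsSum U h fun σ => spin (σ i)
  set R := gibbsSum U h fun σ => spin (σ i) * spin (σ j)
  set P := gibbsSum (removeSite U i) (Function.update (h + siteField U i) i 0) fun _ => 1
  set M := gibbsSum (removeSite U i) (Function.update (h - siteField U i) i 0) fun _ => 1
  set SP := gibbsSum (removeSite U i) (Function.update (h + siteField U i) i 0) fun σ => spin (σ j)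
  set SM := gibbsSum (removeSite U i) (Function.update (h - siteField U i) i 0) fun σ => spin (σ j)
  set a := Real.exp (U i i + h i)
  set b := Real.exp (U i i - h i)
  -- The weights of the spin values `1` and `-1` at `i` are proportional to `a P` and `b M`. Hence
  -- `1 - m_i² = 4 a b P M / (a P + b M)²`, and the identity is algebraic.
  have f1 : Z = (a * P + b * M) / 2 := by linarith
  have f2 : S = (a * SP + b * SM) / 2 := by linarith
  have f3 : T = (a * P - b * M) / 2 := by linarith
  have f4 : R = (a * SP - b * SM) / 2 := by linarith
  have hne : a * P + b * M ≠ 0 := by positivity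
  rw [f1, f2, f3, f4]
  field_simp
  ring

theorem abs_corr_le_abs (U : V → V → ℝ) (h : V → ℝ) {i j : V} (hij : i ≠ j) :
    |corr U h i j| ≤ |(mag (removeSite U i) (h + siteField U i) j -
      mag (removeSite U i) (h - siteField U i) j) / 2| := by
  rw [corr_eq U h hij, abs_mul]
  have h1 : mag U h i ^ 2 ≤ 1 := by
    rw [← sq_abs]; exact pow_le_one₀ (abs_nonneg _) (abs_mag_le U h i)
  refine mul_le_of_le_one_left (abs_nonneg _) ?_
  rw [abs_of_nonneg (by linarith)]
  linarith [sq_nonneg (mag U h i)]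

end Ising

/-! ### Independence by splicing two copies, and a Bessel inequality -/

/-- The configuration which agrees with `x'` on `R` and with `x` off `R`. -/
def splice {ι : Type*} (R : ι → Prop) [DecidablePred R] (x' x : ι → ℝ) : ι → ℝ :=
  fun p => if R p then x' p else x p

theorem continuous_splice {ι : Type*} (R : ι → Prop) [DecidablePred R] :
    Continuous fun z : (ι → ℝ) × (ι → ℝ) => splice R z.1 z.2 := by
  refine continuous_pi fun p => ?_
  by_cases hp : R p <;> simp only [splice, hp, if_true, if_false] <;> fun_prop

/-- This is independence of the coordinates on and off `R`: reading them from two independent copies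
leaves the law unchanged, and Fubini then acts as conditioning. -/
theorem measurePreserving_splice {ι : Type*} [Fintype ι] (R : ι → Prop) [DecidablePred R]
    (μ : Measure ℝ) [IsProbabilityMeasure μ] :
    MeasurePreserving (fun z : (ι → ℝ) × (ι → ℝ) => splice R z.1 z.2)
      ((Measure.pi fun _ => μ).prod (Measure.pi fun _ => μ)) (Measure.pi fun _ => μ) := by
  refine ⟨(continuous_splice R).measurable, (Measure.pi_eq fun s hs => ?_).symm⟩
  rw [Measure.map_apply (continuous_splice R).measurable (.univ_pi hs)]
  have : (fun z : (ι → ℝ) × (ι → ℝ) => splice R z.1 z.2) ⁻¹' Set.univ.pi s =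
      (Set.univ.pi fun p => if R p then s p else Set.univ) ×ˢ
        (Set.univ.pi fun p => if R p then Set.univ else s p) := by
    ext z
    simp only [Set.mem_preimage, Set.mem_pi, Set.mem_univ, true_imp_iff, Set.mem_prod, splice,
      ← forall_and]
    refine forall_congr' fun p => ?_
    by_cases hp : R p <;> simp [hp]
  rw [this, Measure.prod_prod, Measure.pi_pi, Measure.pi_pi, ← Finset.prod_mul_distrib]
  refine Finset.prod_congr rfl fun p _ => ?_
  by_cases hp : R p <;> simp [hp]

theorem integral_splice {ι : Type*} [Fintype ι] (R : ι → Prop) [DecidablePred R]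
    (μ : Measure ℝ) [IsProbabilityMeasure μ] {f : (ι → ℝ) → ℝ} (hf : StronglyMeasurable f) :
    ∫ z : (ι → ℝ) × (ι → ℝ), f (splice R z.1 z.2)
      ∂((Measure.pi fun _ => μ).prod (Measure.pi fun _ => μ)) =
      ∫ x, f x ∂(Measure.pi fun _ => μ) := by
  have := integral_map (μ := (Measure.pi fun _ : ι => μ).prod (Measure.pi fun _ => μ))
    (continuous_splice R).aemeasurable hf.aestronglyMeasurable
  rw [(measurePreserving_splice R μ).map_eq] at this
  exact this.symm

/-- Bessel's inequality for the incidence matrix of a partial injection. -/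
theorem sum_sq_sum_ite_le {P V : Type*} [Fintype P] [Fintype V] (c : P → V → Prop)
    [∀ p k, Decidable (c p k)] (h1 : ∀ p k l, c p k → c p l → k = l)
    (h2 : ∀ p p' k, c p k → c p' k → p = p') (d : V → ℝ) :
    ∑ p, (∑ k, if c p k then d k else 0) ^ 2 ≤ ∑ k, d k ^ 2 := by
  classical
  have e : ∀ p, (∑ k, if c p k then d k else 0) ^ 2 = ∑ k, if c p k then d k ^ 2 else 0 := by
    intro p
    by_cases hp : ∃ k, c p k
    · obtain ⟨k, hk⟩ := hp
      have hz : ∀ l, l ≠ k → ¬ c p l := fun l hl hc => hl (h1 p l k hc hk)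
      rw [Finset.sum_eq_single k (fun l _ hl => if_neg (hz l hl)) (by simp),
        Finset.sum_eq_single k (fun l _ hl => if_neg (hz l hl)) (by simp), if_pos hk, if_pos hk]
    · push Not at hp
      simp [hp]
  simp only [e]
  rw [Finset.sum_comm]
  refine Finset.sum_le_sum fun k _ => ?_
  by_cases hk : ∃ p, c p k
  · obtain ⟨p, hp⟩ := hk
    have hz : ∀ p', p' ≠ p → ¬ c p' k := fun p' hp' hc => hp' (h2 p' p k hc hp)
    rw [Finset.sum_eq_single p (fun l _ hl => if_neg (hz l hl)) (by simp), if_pos hp]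
  · push Not at hk
    simpa [hk] using sq_nonneg (d k)

/-! ### Subsystems and the field exerted by one site -/

/-- The interactions inside a set `B` of sites. -/
def restrictTo {V : Type*} [DecidableEq V] (B : Finset V) (U : V → V → ℝ) : V → V → ℝ :=
  fun k l => if k ∈ B ∧ l ∈ B then U k l else 0

/-- Keeps the recursion inside the family of subsystems `B`, over a fixed set of sites. -/
theorem removeSite_restrictTo {V : Type*} [DecidableEq V] (B : Finset V) (U : V → V → ℝ) (i : V) :
    removeSite (restrictTo B U) i = restrictTo (B.erase i) U := by
  ext k l
  by_cases hk : k = i <;> by_cases hl : l = i <;> simp [removeSite, restrictTo, hk, hl]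

variable {N : ℕ} (A : Finset (Fin N))

/-- The interactions between the free sites, as an upper triangular matrix. -/
def interaction (x : Pair N → ℝ) (k l : Free A) : ℝ :=
  if h : k.1 < l.1 then x ⟨(k.1, l.1), h⟩ else 0

/-- The field exerted by the site `i` on the other sites of `B`. -/
def rowField (B : Finset (Free A)) (i : Free A) (x : Pair N → ℝ) : Free A → ℝ :=
  fun k => if k ≠ i ∧ i ∈ B ∧ k ∈ B then coupling x i.1 k.1 else 0

theorem siteField_restrictTo (B : Finset (Free A)) (i : Free A) (x : Pair N → ℝ) :
    siteField (restrictTo B (interaction A x)) i = rowField A B i x := by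
  ext k
  by_cases hk : k = i
  · simp [siteField, rowField, hk]
  have hne : i.1 ≠ k.1 := fun h => hk (Subtype.ext h.symm)
  by_cases hi : i ∈ B <;> by_cases hkB : k ∈ B <;>
    simp only [siteField, rowField, restrictTo, interaction, coupling, hk, hi, hkB, if_false,
      and_false, if_true, and_true, ne_eq, not_false_iff, add_zero]
  rcases lt_or_gt_of_ne hne with h | h
  · simp [h, not_lt.2 h.le]
  · simp [h, not_lt.2 h.le]

theorem continuous_coupling (i k : Fin N) : Continuous fun x : Pair N → ℝ => coupling x i k := by
  unfold coupling
  split_ifs <;> fun_prop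

theorem continuous_rowField (B : Finset (Free A)) (i : Free A) : Continuous (rowField A B i) := by
  refine continuous_pi fun k => ?_
  unfold rowField
  split_ifs
  · exact continuous_coupling _ _
  · exact continuous_const

theorem continuous_restrictTo_interaction (B : Finset (Free A)) :
    Continuous fun x : Pair N → ℝ => restrictTo B (interaction A x) := by
  refine continuous_pi fun k => continuous_pi fun l => ?_
  unfold restrictTo interaction
  split_ifs <;> fun_prop

theorem coupling_neg (x : Pair N → ℝ) (i k : Fin N) : coupling (-x) i k = -coupling x i k := by
  unfold coupling
  split_ifs <;> simp

theorem rowField_neg (B : Finset (Free A)) (i : Free A) (x : Pair N → ℝ) :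
    rowField A B i (-x) = -rowField A B i x := by
  ext k
  by_cases h : k ≠ i ∧ i ∈ B ∧ k ∈ B
  · simp only [rowField, if_pos h, Pi.neg_apply, coupling_neg]
  · simp only [rowField, if_neg h, Pi.neg_apply, neg_zero]

theorem hasDerivAt_coupling (x : Pair N → ℝ) (p : Pair N) (i k : Fin N) (s : ℝ) :
    HasDerivAt (fun s => coupling (Function.update x p s) i k)
      (if p.1 = (i, k) ∨ p.1 = (k, i) then 1 else 0) s := by
  have key : ∀ p' : Pair N, HasDerivAt (fun s => Function.update x p s p')
      (if p = p' then 1 else 0) s := by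
    intro p'
    by_cases h : p = p'
    · subst h
      simpa using hasDerivAt_id' s
    · simpa [h, Function.update_of_ne (Ne.symm h)] using hasDerivAt_const s (x p')
  have hp : p.1.1 < p.1.2 := p.2
  unfold coupling
  split_ifs with h1 h2 h3 h4 h5
  · refine (key _).congr_deriv (if_pos ?_)
    rcases h2 with h | h
    · exact Subtype.ext h
    · exact absurd hp (by rw [h]; exact not_lt.2 h1.le)
  · exact (key _).congr_deriv (if_neg fun h => h2 (Or.inl (congrArg Subtype.val h)))
  · refine (key _).congr_deriv (if_pos ?_)
    rcases h4 with h | h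
    · exact absurd hp (by rw [h]; exact not_lt.2 h3.le)
    · exact Subtype.ext h
  · exact (key _).congr_deriv (if_neg fun h => h4 (Or.inr (congrArg Subtype.val h)))
  · rcases h5 with h | h
    · exact absurd hp (by rw [h]; exact h1)
    · exact absurd hp (by rw [h]; exact h3)
  · exact hasDerivAt_const _ _

/-- The coupling `p` contributes to the field exerted by `i` on `k`. -/
def Incident (B : Finset (Free A)) (i : Free A) (p : Pair N) (k : Free A) : Prop :=
  (k ≠ i ∧ i ∈ B ∧ k ∈ B) ∧ (p.1 = (i.1, k.1) ∨ p.1 = (k.1, i.1))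

instance (B : Finset (Free A)) (i : Free A) (p : Pair N) (k : Free A) :
    Decidable (Incident A B i p k) := by unfold Incident; infer_instance

theorem hasDerivAt_rowField (B : Finset (Free A)) (i : Free A) (x : Pair N → ℝ) (p : Pair N)
    (k : Free A) (s : ℝ) :
    HasDerivAt (fun s => rowField A B i (Function.update x p s) k)
      (if Incident A B i p k then 1 else 0) s := by
  unfold rowField Incident
  by_cases h : k ≠ i ∧ i ∈ B ∧ k ∈ B
  · simpa only [if_true, h, true_and, ne_eq, not_false_iff, and_self] using
      hasDerivAt_coupling x p i.1 k.1 s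
  · simpa only [if_neg h, h, false_and, if_false] using hasDerivAt_const s (0 : ℝ)

/-- With `i` fixed, a coupling and the other endpoint determine each other. With
`Incident.left_unique` this makes the gradient in the couplings no longer than the gradient in the
field. -/
theorem Incident.right_unique {B : Finset (Free A)} {i : Free A} (p : Pair N) (k l : Free A)
    (hk : Incident A B i p k) (hl : Incident A B i p l) : k = l := by
  have hki : k.1 ≠ i.1 := fun h => hk.1.1 (Subtype.ext h)
  have hli : l.1 ≠ i.1 := fun h => hl.1.1 (Subtype.ext h)
  apply Subtype.ext
  rcases hk.2 with h | h <;> rcases hl.2 with h' | h' <;> rw [h] at h' <;>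
    simp only [Prod.mk.injEq] at h'
  · exact h'.2
  · exact absurd h'.1.symm hli
  · exact absurd h'.1 hki
  · exact h'.1

theorem Incident.left_unique {B : Finset (Free A)} {i : Free A} (p p' : Pair N) (k : Free A)
    (h : Incident A B i p k) (h' : Incident A B i p' k) : p = p' := by
  have hp : p.1.1 < p.1.2 := p.2
  have hp' : p'.1.1 < p'.1.2 := p'.2
  apply Subtype.ext
  rcases h.2 with h | h <;> rcases h'.2 with h' | h' <;> rw [h, h'] <;> rw [h] at hp <;>
    rw [h'] at hp'
  · exact absurd hp (not_lt.2 hp'.le)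
  · exact absurd hp (not_lt.2 hp'.le)

/-- The couplings of the site `i`. -/
def Touches (i : Fin N) (p : Pair N) : Prop := p.1.1 = i ∨ p.1.2 = i

instance (i : Fin N) : DecidablePred (Touches i) := fun p => by unfold Touches; infer_instance

theorem rowField_splice (B : Finset (Free A)) (i : Free A) (x' x : Pair N → ℝ) :
    rowField A B i (splice (Touches i.1) x' x) = rowField A B i x' := by
  ext k
  unfold rowField coupling
  split_ifs <;> simp [splice, Touches]

/-- Counterpart of `rowField_splice`: the field of `i` and the interactions without `i` read
disjoint sets of couplings, hence are independent. -/
theorem restrictTo_erase_splice (B : Finset (Free A)) (i : Free A) (x' x : Pair N → ℝ) :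
    restrictTo (B.erase i) (interaction A (splice (Touches i.1) x' x)) =
      restrictTo (B.erase i) (interaction A x) := by
  ext k l
  unfold restrictTo
  split_ifs with h
  · have hk : k.1 ≠ i.1 := fun e => (Finset.mem_erase.1 h.1).1 (Subtype.ext e)
    have hl : l.1 ≠ i.1 := fun e => (Finset.mem_erase.1 h.2).1 (Subtype.ext e)
    unfold interaction
    split_ifs <;> simp [splice, Touches, hk, hl]
  · rfl

/-! ### Moments of the response to the field of a site -/

/-- Half the effect of reversing the field `r` on the magnetization at `j`. -/
noncomputable def response {V : Type*} [Fintype V] [DecidableEq V] (U : V → V → ℝ) (h r : V → ℝ)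
    (j : V) : ℝ :=
  (mag U (h + r) j - mag U (h - r) j) / 2

/-- The average of the truncated two-point functions in the fields `h + r` and `h - r`. -/
noncomputable def meanCorr {V : Type*} [Fintype V] [DecidableEq V] (U : V → V → ℝ) (h r : V → ℝ)
    (j k : V) : ℝ :=
  (corr U (h + r) j k + corr U (h - r) j k) / 2

theorem abs_response_le {V : Type*} [Fintype V] [DecidableEq V] (U : V → V → ℝ) (h r : V → ℝ)
    (j : V) : |response U h r j| ≤ 1 := by
  have h1 := abs_le.1 (abs_mag_le U (h + r) j)
  have h2 := abs_le.1 (abs_mag_le U (h - r) j)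
  unfold response
  rw [abs_le]
  constructor <;> linarith

theorem abs_meanCorr_le {V : Type*} [Fintype V] [DecidableEq V] (U : V → V → ℝ) (h r : V → ℝ)
    (j k : V) : |meanCorr U h r j k| ≤ 2 := by
  have h1 := abs_le.1 (abs_corr_le U (h + r) j k)
  have h2 := abs_le.1 (abs_corr_le U (h - r) j k)
  unfold meanCorr
  rw [abs_le]
  constructor <;> linarith

theorem abs_rpow_two_mul (a q : ℝ) : |a| ^ (2 * q) = (a ^ 2) ^ q := by
  rw [Real.rpow_mul (abs_nonneg _), Real.rpow_two, sq_abs]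

/-- The term at `j` is not small and is split off at the cost of `2^(q-1)`, harmless for `q` near
one. The power mean inequality handles the rest, and convexity the average of `a` and `b`. -/
theorem sum_sq_rpow_le {V : Type*} [Fintype V] [DecidableEq V] {q : ℝ} (hq : 1 < q) (j : V)
    {a b : V → ℝ} (hab : |(a j + b j) / 2| ≤ 2) :
    (∑ k, ((a k + b k) / 2) ^ 2) ^ q ≤ 2 ^ (q - 1) * (4 ^ q + (Fintype.card V : ℝ) ^ (q - 1) *
      ∑ k ∈ Finset.univ.erase j, (|a k| ^ (2 * q) + |b k| ^ (2 * q)) / 2) := by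
  have hq0 : 0 < q := by linarith
  set d : V → ℝ := fun k => ((a k + b k) / 2) ^ 2
  have hd0 : ∀ k, 0 ≤ d k := fun k => sq_nonneg _
  have hdj : d j ≤ 4 := by
    have := abs_le.1 hab
    simp only [d]
    nlinarith
  have hdk : ∀ k, d k ^ q ≤ (|a k| ^ (2 * q) + |b k| ^ (2 * q)) / 2 := by
    intro k
    have h1 : d k ≤ 1 / 2 * a k ^ 2 + 1 / 2 * b k ^ 2 := by
      simp only [d]; nlinarith [sq_nonneg (a k - b k)]
    have h2 := (convexOn_rpow hq.le).2 (Set.mem_Ici.2 (sq_nonneg (a k)))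
      (Set.mem_Ici.2 (sq_nonneg (b k))) (by norm_num : (0 : ℝ) ≤ 1 / 2)
      (by norm_num : (0 : ℝ) ≤ 1 / 2) (by norm_num)
    simp only [smul_eq_mul] at h2
    rw [abs_rpow_two_mul, abs_rpow_two_mul]
    have h3 := Real.rpow_le_rpow (hd0 k) h1 hq0.le
    linarith
  have hsum0 : 0 ≤ ∑ k ∈ Finset.univ.erase j, d k := Finset.sum_nonneg fun k _ => hd0 k
  have h1 : (∑ k ∈ Finset.univ.erase j, d k) ^ q ≤ (Fintype.card V : ℝ) ^ (q - 1) *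
      ∑ k ∈ Finset.univ.erase j, (|a k| ^ (2 * q) + |b k| ^ (2 * q)) / 2 := by
    have e := Real.rpow_sum_le_const_mul_sum_rpow (Finset.univ.erase j) d hq.le
    simp only [abs_of_nonneg (hd0 _)] at e
    refine e.trans ?_
    have hcard : ((Finset.univ.erase j).card : ℝ) ≤ Fintype.card V := by
      exact_mod_cast Finset.card_le_univ _
    have : ((Finset.univ.erase j).card : ℝ) ^ (q - 1) ≤ (Fintype.card V : ℝ) ^ (q - 1) :=
      Real.rpow_le_rpow (by positivity) hcard (by linarith)
    refine mul_le_mul this (Finset.sum_le_sum fun k _ => hdk k)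
      (Finset.sum_nonneg fun k _ => Real.rpow_nonneg (hd0 k) _) (by positivity)
  rw [← Finset.add_sum_erase _ d (Finset.mem_univ j)]
  have h2 : (d j + ∑ k ∈ Finset.univ.erase j, d k) ^ q ≤
      2 ^ (q - 1) * (d j ^ q + (∑ k ∈ Finset.univ.erase j, d k) ^ q) := by
    have := NNReal.rpow_add_le_mul_rpow_add_rpow ⟨_, hd0 j⟩ ⟨_, hsum0⟩ hq.le
    exact_mod_cast this
  refine h2.trans ?_
  have h3 : d j ^ q ≤ 4 ^ q := Real.rpow_le_rpow (hd0 j) hdj hq0.le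
  gcongr

/-- The law of independent centred Gaussian couplings of variance `v`. -/
noncomputable abbrev couplingLaw (N : ℕ) (v : ℝ≥0) : Measure (Pair N → ℝ) :=
  Measure.pi fun _ => gaussianReal 0 v

/-- The response to the field of a site with Gaussian couplings is controlled by the truncated
two-point functions. -/
theorem integral_response_le (v : ℝ≥0) {q : ℝ} (hq : 1 < q) (U : Free A → Free A → ℝ)
    (h : Free A → ℝ) (B : Finset (Free A)) (i j : Free A) :
    ∫ x, |response U h (rowField A B i x) j| ^ (2 * q) ∂(couplingLaw N v) ≤
      (v * q ^ 2) ^ q *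
        ∫ x, (∑ k, meanCorr U h (rowField A B i x) j k ^ 2) ^ q ∂(couplingLaw N v) := by
  have hrow := continuous_rowField A B i
  have hm : ∀ k, Continuous fun x => meanCorr U h (rowField A B i x) j k := fun k =>
    ((continuous_corr_comp continuous_const (continuous_const.add hrow) j k).add
      (continuous_corr_comp continuous_const (continuous_const.sub hrow) j k)).div_const 2
  set C : ℝ := 1 + Fintype.card (Free A) * 2
  have hcard : (0 : ℝ) ≤ Fintype.card (Free A) := by positivity
  have hder : ∀ x p, HasDerivAt
      (fun s => response U h (rowField A B i (Function.update x p s)) j)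
      (∑ k, if Incident A B i p k then meanCorr U h (rowField A B i x) j k else 0) (x p) := by
    intro x p
    have h1 : ∀ k, HasDerivAt (fun s => (h + rowField A B i (Function.update x p s)) k)
        (if Incident A B i p k then 1 else 0) (x p) := fun k =>
      (hasDerivAt_rowField A B i x p k (x p)).const_add (h k)
    have h2 : ∀ k, HasDerivAt (fun s => (h - rowField A B i (Function.update x p s)) k)
        (-(if Incident A B i p k then 1 else 0)) (x p) := fun k =>
      (hasDerivAt_rowField A B i x p k (x p)).const_sub (h k)
    refine (((hasDerivAt_mag U h1 j).sub (hasDerivAt_mag U h2 j)).div_const 2).congr_deriv ?_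
    rw [← Finset.sum_sub_distrib, Finset.sum_div]
    refine Finset.sum_congr rfl fun k _ => ?_
    rw [Function.update_eq_self]
    split_ifs
    · simp only [meanCorr]; ring
    · simp
  have hder_bound : ∀ p x,
      |∑ k, if Incident A B i p k then meanCorr U h (rowField A B i x) j k else 0| ≤ C := by
    intro p x
    calc _ ≤ ∑ k, |if Incident A B i p k then meanCorr U h (rowField A B i x) j k else 0| :=
          Finset.abs_sum_le_sum_abs _ _
      _ ≤ ∑ _k : Free A, (2 : ℝ) := Finset.sum_le_sum fun k _ => by
          split_ifs
          · exact abs_meanCorr_le _ _ _ _ _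
          · simp
      _ ≤ C := by simp [C]
  refine (integral_abs_rpow_le_of_odd v hq (C := C)
    (u := fun x => response U h (rowField A B i x) j)
    (u' := fun p x => ∑ k, if Incident A B i p k then meanCorr U h (rowField A B i x) j k else 0)
    ?_ ?_ ?_ ?_ hder_bound hder).trans ?_
  · exact ((continuous_mag_comp continuous_const (continuous_const.add hrow) j).sub
      (continuous_mag_comp continuous_const (continuous_const.sub hrow) j)).div_const 2
  · exact fun x => (abs_response_le _ _ _ _).trans (by simp only [C]; linarith)
  · intro x
    simp only [response, rowField_neg, sub_neg_eq_add, ← sub_eq_add_neg]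
    ring
  · intro p
    refine continuous_finsetSum _ fun k _ => ?_
    split_ifs
    · exact hm k
    · exact continuous_const
  · refine mul_le_mul_of_nonneg_left ?_ (by positivity)
    -- Each coupling moves the field at no more than one site, so the squared gradient is bounded by
    -- the sum over sites.
    have hle : ∀ x, ∑ p : Pair N, (∑ k, if Incident A B i p k then
        meanCorr U h (rowField A B i x) j k else 0) ^ 2 ≤
        ∑ k, meanCorr U h (rowField A B i x) j k ^ 2 := fun x =>
      sum_sq_sum_ite_le _ (Incident.right_unique A) (Incident.left_unique A) _
    refine integral_mono_of_nonneg (ae_of_all _ fun x =>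
      Real.rpow_nonneg (Finset.sum_nonneg fun p _ => sq_nonneg _) _) ?_
      (ae_of_all _ fun x => Real.rpow_le_rpow (Finset.sum_nonneg fun p _ => sq_nonneg _) (hle x)
        (by linarith))
    refine integrable_of_abs_le (C := (Fintype.card (Free A) * 4) ^ q)
      ((continuous_finsetSum _ fun k _ => (hm k).pow 2).rpow_const
        fun _ => Or.inr (by linarith)).stronglyMeasurable fun x => ?_
    have h0 : 0 ≤ ∑ k, meanCorr U h (rowField A B i x) j k ^ 2 :=
      Finset.sum_nonneg fun p _ => sq_nonneg _
    rw [abs_of_nonneg (Real.rpow_nonneg h0 _)]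
    refine Real.rpow_le_rpow h0 ?_ (by linarith)
    calc _ ≤ ∑ _k : Free A, (4 : ℝ) := Finset.sum_le_sum fun k _ => by
          have := abs_le.1 (abs_meanCorr_le U h (rowField A B i x) j k)
          nlinarith
      _ = _ := by simp

/-- Integrating out a Gaussian field after the moment bounds for the fields held fixed. -/
theorem integral_prod_abs_rpow_le {X V : Type*} [TopologicalSpace X] [SecondCountableTopology X]
    [MeasurableSpace X] [BorelSpace X] [Fintype V] [DecidableEq V] (π : Measure X)
    [IsProbabilityMeasure π] {q : ℝ} (hq : 1 < q) (j : V) {a b : V → X × X → ℝ} {r : X × X → ℝ}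
    (hac : ∀ k, Continuous (a k)) (hbc : ∀ k, Continuous (b k)) (hrc : Continuous r)
    (ha : ∀ k z, |a k z| ≤ 2) (hb : ∀ k z, |b k z| ≤ 2) (hr : ∀ z, |r z| ≤ 1) {M c : ℝ}
    (hc : 0 ≤ c)
    (haM : ∀ k, j ≠ k → ∀ x', ∫ x, |a k (x', x)| ^ (2 * q) ∂π ≤ M)
    (hbM : ∀ k, j ≠ k → ∀ x', ∫ x, |b k (x', x)| ^ (2 * q) ∂π ≤ M)
    (hM : 0 ≤ M)
    (h : ∀ x, ∫ x', |r (x', x)| ^ (2 * q) ∂π ≤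
      c * ∫ x', (∑ k, ((a k (x', x) + b k (x', x)) / 2) ^ 2) ^ q ∂π) :
    ∫ z, |r z| ^ (2 * q) ∂(π.prod π) ≤
      c * (2 ^ (q - 1) * (4 ^ q + (Fintype.card V : ℝ) ^ q * M)) := by
  have hq0 : 0 < q := by linarith
  obtain ⟨n, hn⟩ : ∃ n : ℝ, n = (Fintype.card V : ℝ) := ⟨_, rfl⟩
  have hn0 : 0 < n := by
    rw [hn]
    exact Nat.cast_pos.2 (Fintype.card_pos_iff.2 ⟨j⟩)
  have hcard : ((Finset.univ.erase j).card : ℝ) ≤ n := by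
    rw [hn]
    exact_mod_cast Finset.card_le_univ _
  have hpow : ∀ {f : X × X → ℝ}, Continuous f → Continuous fun x => |f x| ^ (2 * q) := fun hf =>
    hf.abs.rpow_const fun _ => Or.inr (by linarith)
  have hbd : ∀ {y : ℝ}, |y| ≤ 2 → |(|y| ^ (2 * q))| ≤ 2 ^ (2 * q) := fun hy => by
    rw [abs_of_nonneg (by positivity)]
    exact Real.rpow_le_rpow (abs_nonneg _) hy (by linarith)
  have iR : Integrable (fun z => |r z| ^ (2 * q)) (π.prod π) :=
    integrable_of_abs_le (hpow hrc).stronglyMeasurable fun z =>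
      hbd ((hr z).trans (by norm_num))
  have i1 : ∀ k, Integrable (fun z => |a k z| ^ (2 * q)) (π.prod π) := fun k =>
    integrable_of_abs_le (hpow (hac k)).stronglyMeasurable fun z => hbd (ha k z)
  have i2 : ∀ k, Integrable (fun z => |b k z| ^ (2 * q)) (π.prod π) := fun k =>
    integrable_of_abs_le (hpow (hbc k)).stronglyMeasurable fun z => hbd (hb k z)
  have i12 : ∀ k, Integrable (fun z => (|a k z| ^ (2 * q) + |b k z| ^ (2 * q)) / 2) (π.prod π) :=
    fun k => ((i1 k).add (i2 k)).div_const 2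
  -- `Γ` is the majorant from `sum_sq_rpow_le`; being affine in the `2q`-th powers, it integrates to
  -- a bound in terms of `M`.
  obtain ⟨Γ, hΓ⟩ : ∃ Γ : X × X → ℝ, ∀ z, Γ z = 2 ^ (q - 1) * (4 ^ q + n ^ (q - 1) *
    ∑ k ∈ Finset.univ.erase j, (|a k z| ^ (2 * q) + |b k z| ^ (2 * q)) / 2) := ⟨_, fun _ => rfl⟩
  have hΓe : Γ = fun z => 2 ^ (q - 1) * (4 ^ q + n ^ (q - 1) *
    ∑ k ∈ Finset.univ.erase j, (|a k z| ^ (2 * q) + |b k z| ^ (2 * q)) / 2) := funext hΓ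
  have hΓc : Continuous Γ := by
    rw [hΓe]
    exact continuous_const.mul (continuous_const.add (continuous_const.mul
      (continuous_finsetSum _ fun k _ => ((hpow (hac k)).add (hpow (hbc k))).div_const 2)))
  have hΓ0 : ∀ z, 0 ≤ Γ z := fun z => by rw [hΓ]; positivity
  have hΓb : ∀ z, |Γ z| ≤ 2 ^ (q - 1) * (4 ^ q + n ^ (q - 1) * (n * 2 ^ (2 * q))) := by
    intro z
    rw [abs_of_nonneg (hΓ0 z), hΓ]
    have : ∑ k ∈ Finset.univ.erase j, (|a k z| ^ (2 * q) + |b k z| ^ (2 * q)) / 2 ≤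
        n * 2 ^ (2 * q) := by
      calc _ ≤ ∑ _k ∈ Finset.univ.erase j, (2 : ℝ) ^ (2 * q) :=
            Finset.sum_le_sum fun k _ => by
              have e1 := (le_abs_self _).trans (hbd (ha k z))
              have e2 := (le_abs_self _).trans (hbd (hb k z))
              linarith
        _ ≤ n * 2 ^ (2 * q) := by
            rw [Finset.sum_const, nsmul_eq_mul]
            gcongr
    gcongr
  have iΓ : Integrable Γ (π.prod π) := integrable_of_abs_le hΓc.stronglyMeasurable hΓb
  have hmean : ∀ g : X → ℝ, (∀ x, g x ≤ M) → Integrable g π → ∫ x, g x ∂π ≤ M := fun g hg hi => by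
    have := integral_mono hi (integrable_const M) hg
    simpa using this
  have eΓ : ∫ z, Γ z ∂(π.prod π) ≤ 2 ^ (q - 1) * (4 ^ q + n ^ q * M) := by
    have hk : ∀ k ∈ Finset.univ.erase j,
        ∫ z, (|a k z| ^ (2 * q) + |b k z| ^ (2 * q)) / 2 ∂(π.prod π) ≤ M := by
      intro k hk
      have hjk : j ≠ k := (Finset.mem_erase.1 hk).1.symm
      -- Here the first variable, which fixes the field, stays outside. The bound on `r` below
      -- integrates in the opposite order.
      have a1 : ∫ z, |a k z| ^ (2 * q) ∂(π.prod π) ≤ M := by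
        rw [integral_prod _ (i1 k)]
        exact hmean _ (haM k hjk) (i1 k).integral_prod_left
      have a2 : ∫ z, |b k z| ^ (2 * q) ∂(π.prod π) ≤ M := by
        rw [integral_prod _ (i2 k)]
        exact hmean _ (hbM k hjk) (i2 k).integral_prod_left
      rw [integral_div, integral_add (i1 k) (i2 k)]
      linarith
    rw [hΓe, integral_const_mul, integral_add (integrable_const _)
      ((integrable_finsetSum _ fun k _ => i12 k).const_mul _), integral_const_mul,
      integral_finsetSum _ fun k _ => i12 k]
    have hsum := Finset.sum_le_sum hk
    have hnq : n ^ q = n ^ (q - 1) * n := by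
      rw [← Real.rpow_add_one hn0.ne', sub_add_cancel]
    rw [hnq, mul_assoc]
    simp only [Finset.sum_const, nsmul_eq_mul, integral_const, probReal_univ, one_smul] at hsum ⊢
    have h2 : ((Finset.univ.erase j).card : ℝ) * M ≤ n * M := by gcongr
    have h3 := hsum.trans h2
    gcongr
  rw [← hn]
  calc ∫ z, |r z| ^ (2 * q) ∂(π.prod π) = ∫ x, ∫ x', |r (x', x)| ^ (2 * q) ∂π ∂π :=
        integral_prod_symm _ iR
    _ ≤ ∫ x, c * ∫ x', Γ (x', x) ∂π ∂π := by
        refine integral_mono_of_nonneg (ae_of_all _ fun x => integral_nonneg fun x' => by positivity)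
          (iΓ.integral_prod_right.const_mul _) (ae_of_all _ fun x => ?_)
        refine (h x).trans (mul_le_mul_of_nonneg_left ?_ hc)
        have hΓi : Integrable (fun x' => Γ (x', x)) π :=
          integrable_of_abs_le (hΓc.comp (by fun_prop :
            Continuous fun x' : X => (x', x))).stronglyMeasurable fun x' => hΓb _
        refine integral_mono_of_nonneg (ae_of_all _ fun x' =>
          Real.rpow_nonneg (Finset.sum_nonneg fun k _ => sq_nonneg _) _) hΓi
          (ae_of_all _ fun x' => ?_)
        simp only [hΓ, hn]
        refine sum_sq_rpow_le hq j (abs_le.2 ?_)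
        have e1 := abs_le.1 (ha j (x', x))
        have e2 := abs_le.1 (hb j (x', x))
        constructor <;> linarith
    _ = c * ∫ z, Γ z ∂(π.prod π) := by rw [integral_const_mul, integral_prod_symm _ iΓ]
    _ ≤ c * (2 ^ (q - 1) * (4 ^ q + n ^ q * M)) := mul_le_mul_of_nonneg_left eΓ hc

/-! ### The recursion over subsystems -/

/-- The moments of the truncated two-point functions of the system on `B` are controlled by those
of the system with a site removed. -/
theorem integral_corr_le_of_erase (v : ℝ≥0) {q : ℝ} (hq : 1 < q) (B : Finset (Free A))
    {i j : Free A} (hij : i ≠ j) {M : ℝ}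
    (hM : ∀ (h : Free A → ℝ) (k l : Free A), k ≠ l →
      ∫ x, |corr (restrictTo (B.erase i) (interaction A x)) h k l| ^ (2 * q)
        ∂(couplingLaw N v) ≤ M) (h : Free A → ℝ) :
    ∫ x, |corr (restrictTo B (interaction A x)) h i j| ^ (2 * q) ∂(couplingLaw N v) ≤
      (v * q ^ 2) ^ q * (2 ^ (q - 1) * (4 ^ q + (Fintype.card (Free A) : ℝ) ^ q * M)) := by
  have hrow := continuous_rowField A B i
  have hM0 : 0 ≤ M := (integral_nonneg fun x => by positivity).trans (hM h i j hij)
  have hU := continuous_restrictTo_interaction A (B.erase i)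
  have hpU : Continuous fun z : (Pair N → ℝ) × (Pair N → ℝ) =>
      restrictTo (B.erase i) (interaction A z.2) := hU.comp continuous_snd
  have hpf : Continuous fun z : (Pair N → ℝ) × (Pair N → ℝ) => h + rowField A B i z.1 :=
    continuous_const.add (hrow.comp continuous_fst)
  have hmf : Continuous fun z : (Pair N → ℝ) × (Pair N → ℝ) => h - rowField A B i z.1 :=
    continuous_const.sub (hrow.comp continuous_fst)
  have hresp : Continuous fun z : (Pair N → ℝ) × (Pair N → ℝ) =>
      response (restrictTo (B.erase i) (interaction A z.2)) h (rowField A B i z.1) j :=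
    ((continuous_mag_comp hpU hpf j).sub (continuous_mag_comp hpU hmf j)).div_const 2
  have ha : ∀ k, Continuous fun z : (Pair N → ℝ) × (Pair N → ℝ) =>
      corr (restrictTo (B.erase i) (interaction A z.2)) (h + rowField A B i z.1) j k :=
    continuous_corr_comp hpU hpf j
  have hb : ∀ k, Continuous fun z : (Pair N → ℝ) × (Pair N → ℝ) =>
      corr (restrictTo (B.erase i) (interaction A z.2)) (h - rowField A B i z.1) j k :=
    continuous_corr_comp hpU hmf j
  have hdiag : StronglyMeasurable fun x =>
      |response (restrictTo (B.erase i) (interaction A x)) h (rowField A B i x) j| ^ (2 * q) :=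
    ((hresp.comp (by fun_prop : Continuous fun x : Pair N → ℝ => (x, x))).abs.rpow_const
      fun _ => Or.inr (by linarith)).stronglyMeasurable
  have hstep : ∀ x, |corr (restrictTo B (interaction A x)) h i j| ^ (2 * q) ≤
      |response (restrictTo (B.erase i) (interaction A x)) h (rowField A B i x) j| ^ (2 * q) := by
    intro x
    refine Real.rpow_le_rpow (abs_nonneg _) ?_ (by linarith)
    have := abs_corr_le_abs (restrictTo B (interaction A x)) h hij
    rwa [removeSite_restrictTo, siteField_restrictTo] at this
  have hmono := integral_mono_of_nonneg (μ := couplingLaw N v)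
    (ae_of_all _ fun x => by positivity)
    (integrable_of_abs_le (C := 1) hdiag fun x => by
      rw [abs_of_nonneg (by positivity)]
      exact Real.rpow_le_one (abs_nonneg _) (abs_response_le _ _ _ _) (by linarith))
    (ae_of_all _ hstep)
  refine hmono.trans ?_
  -- The couplings of `i` are taken from a separate copy, so the field of `i` can be frozen while
  -- the other interactions are averaged.
  rw [← integral_splice (Touches i.1) (gaussianReal 0 v) hdiag]
  simp only [rowField_splice, restrictTo_erase_splice]
  have habs : ∀ (h' : Free A → ℝ) (k : Free A) (x : Pair N → ℝ),
      |corr (restrictTo (B.erase i) (interaction A x)) h' j k| ≤ 2 := fun h' k x =>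
    abs_corr_le _ h' j k
  have hr : ∀ x' x : Pair N → ℝ,
      |response (restrictTo (B.erase i) (interaction A x)) h (rowField A B i x') j| ≤ 1 :=
    fun x' x => abs_response_le _ h _ j
  have hinner : ∀ x : Pair N → ℝ, _ := fun x =>
    integral_response_le A v hq (restrictTo (B.erase i) (interaction A x)) h B i j
  simp only [meanCorr] at hinner
  have key := integral_prod_abs_rpow_le (couplingLaw N v) hq j ha hb hresp
    (fun k z => habs (h + rowField A B i z.1) k z.2)
    (fun k z => habs (h - rowField A B i z.1) k z.2) (fun z => hr z.1 z.2)
    (by positivity : 0 ≤ ((v : ℝ) * q ^ 2) ^ q)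
    (fun k hk x' => hM (h + rowField A B i x') j k hk)
    (fun k hk x' => hM (h - rowField A B i x') j k hk) hM0 hinner
  exact key

/-- A site outside `B` exerts no field, so there is nothing for `j` to respond to. -/
theorem corr_eq_zero_of_notMem {B : Finset (Free A)} {i j : Free A} (hij : i ≠ j) (hi : i ∉ B)
    (x : Pair N → ℝ) (h : Free A → ℝ) : corr (restrictTo B (interaction A x)) h i j = 0 := by
  have hz : rowField A B i x = 0 := by
    ext k
    simp [rowField, hi]
  rw [corr_eq _ _ hij, siteField_restrictTo, hz]
  simp

/-- The constant of the site-removal recursion is less than one. -/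
theorem recursion_constant_le {t q : ℝ} (ht0 : 0 ≤ t) (ht : t < Real.log 2) (hq : 1 < q)
    (hq' : q ≤ 11 / 10) : (t * q ^ 2) ^ q * 2 ^ (q - 1) ≤ 93 / 100 := by
  have hlog := Real.log_two_lt_d9
  have hq2 : q ^ 2 ≤ 121 / 100 := by nlinarith
  have h0 : 0 ≤ t * q ^ 2 := by positivity
  -- `log 2 < 0.6932` and `q² ≤ 1.21`. The base being below one, raising it to the power `q` only
  -- decreases it.
  have h1 : t * q ^ 2 ≤ 84 / 100 := by nlinarith
  have h2 : (t * q ^ 2) ^ q ≤ 84 / 100 := by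
    have := Real.rpow_le_rpow_of_exponent_ge' h0 (by linarith) zero_le_one hq.le
    rw [Real.rpow_one] at this
    linarith
  have h3 : (2 : ℝ) ^ (q - 1) ≤ 11 / 10 := by
    have := rpow_one_add_le_one_add_mul_self (s := 1) (by norm_num) (p := q - 1) (by linarith)
      (by linarith)
    norm_num at this
    linarith
  calc _ ≤ (84 / 100 : ℝ) * (11 / 10) := by gcongr
    _ ≤ _ := by norm_num

/-- Moments of the truncated two-point functions for an arbitrary deterministic external field. -/
theorem integral_corr_le {t q : ℝ} (ht0 : 0 ≤ t) (ht : t < Real.log 2) (hq : 1 < q)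
    (hq' : q ≤ 11 / 10) (B : Finset (Free A)) (h : Free A → ℝ) {i j : Free A} (hij : i ≠ j) :
    ∫ x, |corr (restrictTo B (interaction A x)) h i j| ^ (2 * q)
      ∂(couplingLaw N (Real.toNNReal (t / N))) ≤ 93 / 7 * 4 ^ q / (N : ℝ) ^ q := by
  induction hn : B.card generalizing B h i j with
  | zero =>
    have hB : B = ∅ := Finset.card_eq_zero.1 hn
    simp only [corr_eq_zero_of_notMem A hij (B := B) (by simp [hB]), abs_zero,
      Real.zero_rpow (by linarith : 2 * q ≠ 0), integral_zero]
    positivity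
  | succ n ih =>
    by_cases hi : i ∈ B
    swap
    · simp only [corr_eq_zero_of_notMem A hij hi, abs_zero,
        Real.zero_rpow (by linarith : 2 * q ≠ 0), integral_zero]
      positivity
    have hM := fun (h : Free A → ℝ) (k l : Free A) (hkl : k ≠ l) =>
      ih (B.erase i) h hkl (by rw [Finset.card_erase_of_mem hi, hn, Nat.add_sub_cancel])
    refine (integral_corr_le_of_erase A _ hq B hij hM h).trans ?_
    have hN : 0 < (N : ℝ) := Nat.cast_pos.2 (Fin.pos i.1)
    have hv : ((Real.toNNReal (t / N) : ℝ≥0) : ℝ) = t / N := Real.coe_toNNReal _ (by positivity)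
    have hcard : (Fintype.card (Free A) : ℝ) ≤ N := by
      have := Fintype.card_subtype_le fun i : Fin N => i ∉ A
      rw [Fintype.card_fin] at this
      exact_mod_cast this
    have hNq : 0 < (N : ℝ) ^ q := Real.rpow_pos_of_pos hN q
    have hcq : (Fintype.card (Free A) : ℝ) ^ q ≤ (N : ℝ) ^ q :=
      Real.rpow_le_rpow (by positivity) hcard (by linarith)
    have e : (t / N * q ^ 2) ^ q = (t * q ^ 2) ^ q / (N : ℝ) ^ q := by
      rw [← Real.div_rpow (by positivity) hN.le]
      congr 1
      ring
    have hρ := recursion_constant_le ht0 ht hq hq'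
    have h4 : (0 : ℝ) < 4 ^ q := by positivity
    rw [hv, e]
    -- `93/7` is the fixed point of `K = 93/100 * (1 + K)`, so the bound reproduces itself.
    calc _ ≤ (t * q ^ 2) ^ q / (N : ℝ) ^ q *
          (2 ^ (q - 1) * (4 ^ q + (N : ℝ) ^ q * (93 / 7 * 4 ^ q / (N : ℝ) ^ q))) := by gcongr
      _ = (t * q ^ 2) ^ q * 2 ^ (q - 1) * (100 / 7 * 4 ^ q / (N : ℝ) ^ q) := by
          field_simp
          ring
      _ ≤ 93 / 100 * (100 / 7 * 4 ^ q / (N : ℝ) ^ q) := by gcongr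
      _ = _ := by ring

/-! ### The boundary condition -/

/-- The external field on the free sites exerted by the spins in `A`. -/
noncomputable def boundaryField (h : ℝ) (τ : A → ℤˣ) (x : Pair N → ℝ) : Free A → ℝ :=
  fun k => h + ∑ j : A, coupling x k.1 j * spin (τ j)

theorem continuous_boundaryField (h : ℝ) (τ : A → ℤˣ) : Continuous (boundaryField A h τ) := by
  refine continuous_pi fun k => continuous_const.add (continuous_finsetSum _ fun j _ => ?_)
  exact (continuous_coupling _ _).mul continuous_const

theorem hamiltonian_coupling (x : Pair N → ℝ) (h : ℝ) (τ : A → ℤˣ) (σ : Free A → ℤˣ) :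
    hamiltonian (coupling x) h A τ σ =
      energy (restrictTo Finset.univ (interaction A x)) (boundaryField A h τ x) σ := by
  unfold hamiltonian energy boundaryField
  congr 1
  refine Finset.sum_congr rfl fun k _ => Finset.sum_congr rfl fun l _ => ?_
  by_cases hkl : k.1 < l.1
  · simp [restrictTo, interaction, coupling, hkl]
  · simp [restrictTo, interaction, hkl]

theorem twoPoint_coupling (x : Pair N → ℝ) (h : ℝ) (τ : A → ℤˣ) (i j : Free A) :
    twoPoint (coupling x) h A τ i j =
      corr (restrictTo Finset.univ (interaction A x)) (boundaryField A h τ x) i j := by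
  simp only [twoPoint, magnetization, gibbs, partitionFunction, hamiltonian_coupling, corr, mag,
    gibbsAvg, gibbsSum, one_mul]

theorem continuous_twoPoint_coupling (h : ℝ) (τ : A → ℤˣ) (i j : Free A) :
    Continuous fun x : Pair N → ℝ => twoPoint (coupling x) h A τ i j := by
  simp only [twoPoint_coupling]
  exact continuous_corr_comp (continuous_restrictTo_interaction A _)
    (continuous_boundaryField A h τ) i j

theorem abs_twoPoint_coupling_le (x : Pair N → ℝ) (h : ℝ) (τ : A → ℤˣ) (i j : Free A) :
    |twoPoint (coupling x) h A τ i j| ≤ 2 := by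
  rw [twoPoint_coupling]
  exact abs_corr_le _ _ _ _

theorem stronglyMeasurable_abs_twoPoint_rpow {q : ℝ} (hq : 0 ≤ q) (h : ℝ) (τ : A → ℤˣ)
    (i j : Free A) :
    StronglyMeasurable fun x : Pair N → ℝ => |twoPoint (coupling x) h A τ i j| ^ q :=
  ((continuous_twoPoint_coupling A h τ i j).abs.rpow_const fun _ => Or.inr hq).stronglyMeasurable

theorem abs_abs_twoPoint_rpow_le {q : ℝ} (hq : 0 ≤ q) (h : ℝ) (τ : A → ℤˣ) (i j : Free A)
    (x : Pair N → ℝ) : |(|twoPoint (coupling x) h A τ i j| ^ q)| ≤ 2 ^ q := by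
  rw [abs_of_nonneg (by positivity)]
  exact Real.rpow_le_rpow (abs_nonneg _) (abs_twoPoint_coupling_le A x h τ i j) hq

/-- The coupling `p` involves a site of `A`. -/
def TouchesSet (p : Pair N) : Prop := p.1.1 ∈ A ∨ p.1.2 ∈ A

instance : DecidablePred (TouchesSet A) := fun p => by unfold TouchesSet; infer_instance

/-- Couplings to `A` enter only the field and couplings between free sites only the interaction, so
the field can be conditioned on. -/
theorem twoPoint_coupling_splice (x' x : Pair N → ℝ) (h : ℝ) (τ : A → ℤˣ) (i j : Free A) :
    twoPoint (coupling (splice (TouchesSet A) x' x)) h A τ i j =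
      corr (restrictTo Finset.univ (interaction A x)) (boundaryField A h τ x') i j := by
  have h1 : interaction A (splice (TouchesSet A) x' x) = interaction A x := by
    ext k l
    unfold interaction
    split_ifs <;> simp [splice, TouchesSet, k.2, l.2]
  have h2 : boundaryField A h τ (splice (TouchesSet A) x' x) = boundaryField A h τ x' := by
    ext k
    unfold boundaryField
    congr 1
    refine Finset.sum_congr rfl fun l _ => ?_
    congr 1
    unfold coupling
    split_ifs <;> simp [splice, TouchesSet, l.2]
  rw [twoPoint_coupling, h1, h2]

/-- Given the couplings to `A`, the boundary field is deterministic, and `integral_corr_le` holds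
for every such field. -/
theorem integral_twoPoint_le {t q : ℝ} (ht0 : 0 ≤ t) (ht : t < Real.log 2) (hq : 1 < q)
    (hq' : q ≤ 11 / 10) (h : ℝ) (τ : A → ℤˣ) {i j : Free A} (hij : i ≠ j) :
    ∫ x, |twoPoint (coupling x) h A τ i j| ^ (2 * q)
      ∂(couplingLaw N (Real.toNNReal (t / N))) ≤ 93 / 7 * 4 ^ q / (N : ℝ) ^ q := by
  have hq2 : 0 ≤ 2 * q := by linarith
  have hm := stronglyMeasurable_abs_twoPoint_rpow A hq2 h τ i j
  have hi : Integrable (fun z : (Pair N → ℝ) × (Pair N → ℝ) =>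
      |twoPoint (coupling (splice (TouchesSet A) z.1 z.2)) h A τ i j| ^ (2 * q))
      ((couplingLaw N (Real.toNNReal (t / N))).prod (couplingLaw N (Real.toNNReal (t / N)))) :=
    integrable_of_abs_le (hm.comp_measurable (continuous_splice (TouchesSet A)).measurable)
      fun z => abs_abs_twoPoint_rpow_le A hq2 h τ i j _
  rw [← integral_splice (TouchesSet A) (gaussianReal 0 (Real.toNNReal (t / N))) hm,
    integral_prod _ hi]
  have := integral_mono hi.integral_prod_left
    (integrable_const (93 / 7 * 4 ^ q / (N : ℝ) ^ q)) fun x' => by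
      simp only [twoPoint_coupling_splice]
      exact integral_corr_le A ht0 ht hq hq' Finset.univ (boundaryField A h τ x') hij
  simpa using this

end SK

/-! ### Transfer to an arbitrary probability space -/

theorem lemma3p1 (t : ℝ) (ht0 : 0 ≤ t) (ht : t < Real.log 2) :
    ∃ ε₀ : ℝ, 0 < ε₀ ∧ ∀ ε : ℝ, 0 < ε → ε ≤ ε₀ →
      ∃ C : ℝ, 0 < C ∧
        ∀ (N : ℕ) (h : ℝ) (Ω : Type*) [MeasurableSpace Ω] (P : Measure Ω)
          [IsProbabilityMeasure P] (g : SK.Pair N → Ω → ℝ),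
          (∀ p, HasLaw (g p) (gaussianReal 0 (Real.toNNReal (t / (N : ℝ)))) P) →
          iIndepFun g P →
          ∀ (A : Finset (Fin N)) (i j : SK.Free A), i ≠ j →
            (∀ τ : A → ℤˣ, Integrable
              (fun ω => |SK.twoPoint (SK.coupling fun p => g p ω) h A τ i j| ^ (2 + ε)) P) ∧
            (⨆ τ : A → ℤˣ,
              ∫ ω, |SK.twoPoint (SK.coupling fun p => g p ω) h A τ i j| ^ (2 + ε) ∂P)
              ≤ C / (N : ℝ) ^ (1 + ε / 2) := by
  -- With `q = 1 + ε/2`, the condition `q ≤ 11/10` reads `ε ≤ 1/5`.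
  refine ⟨1 / 5, by norm_num, fun ε hε hε' => ⟨93 / 7 * 4 ^ (1 + ε / 2), by positivity, ?_⟩⟩
  intro N h Ω _ P _ g hg hind A i j hij
  have hgm : ∀ p, AEMeasurable (g p) P := fun p => (hg p).aemeasurable
  have hmeas : AEMeasurable (fun ω p => g p ω) P := aemeasurable_pi_lambda _ hgm
  -- Independence and the marginal laws identify the joint law with the product measure.
  have hmap : P.map (fun ω p => g p ω) = SK.couplingLaw N (Real.toNNReal (t / N)) := by
    rw [(iIndepFun_iff_map_fun_eq_pi_map hgm).1 hind]
    simp only [(hg _).map_eq]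
  have hε2 : 2 + ε = 2 * (1 + ε / 2) := by ring
  have hsm := fun τ => SK.stronglyMeasurable_abs_twoPoint_rpow A
    (by linarith : 0 ≤ 2 + ε) h τ i j
  refine ⟨fun τ => ?_, ciSup_le fun τ => ?_⟩
  · have hint : Integrable (fun x => |SK.twoPoint (SK.coupling x) h A τ i j| ^ (2 + ε))
        (P.map fun ω p => g p ω) := by
      rw [hmap]
      exact SK.integrable_of_abs_le (hsm τ)
        (SK.abs_abs_twoPoint_rpow_le A (by linarith) h τ i j)
    exact hint.comp_aemeasurable hmeas
  · have e := integral_map (μ := P) hmeas (hsm τ).aestronglyMeasurable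
    rw [← e, hmap, hε2]
    exact SK.integral_twoPoint_le A ht0 ht (by linarith) (by linarith) h τ hij
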